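/- **Proposition 5.3.** *Setting.* Let $\mu$ be the normalized surface measure on the unit sphere $\mathbb S^2\subset\mathbb R^3$, let $\{Y_{\ell,m}:\ell\ge 0,\ -\ell\le m\le\ell\}$ be the complex orthonormal spherical harmonics of $L_2(\mathbb S^2,\mu)$, given for $0\le m\le\ell$ by $Y_{\ell,m}(\theta,\varphi)=\sqrt{\tfrac{(2\ell+1)(\ell-m)!}{(\ell+m)!}}\,P_{\ell,m}(\cos\theta)e^{\mathrm i m\varphi}$ with $P_{\ell,m}(x)=(-1)^m(1-x^2)^{m/2}\frac{d^m}{dx^m}P_\ell(x)$ ($P_\ell$ the Legendre polynomial), and for $m<0$ by $Y_{\ell,m}=(-1)^m\overline{Y_{\ell,-m}}$. Let $\lambda_\ell:=\ell(\ell+1)$, $0<\alpha\le 1$, $\tau\ge 0$, and $E_\alpha(z):=\sum_{k\ge0} z^k/\Gamma(\alpha k+1)$. Let $W_\tau(t)$, $t\ge\tau$, be a real $L_2(\mathbb S^2)$-valued time-delayed Brownian motion on a probability space $(\Omega,\mathcal F,\mathbb P)$, i.e. a $Q$-Wiener process on $[\tau,\infty)$: $W_\tau(\tau)=0$, continuous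 trajectories, independent increments, and $W_\tau(t)-W_\tau(s)\sim\mathcal N(0,(t-s)Q)$ for $t\ge s\ge\tau$. Let $\{\mathcal A_\ell\}_{\ell\ge0}$ be its angular power spectrum, i.e. $\mathcal A_\ell\ge0$ and $QY_{\ell,m}=\mathcal A_\ell Y_{\ell,m}$, and suppose that for some constants $\widetilde K,\widetilde A>0$ and $\kappa_2>2$ $$\mathcal A_0\le\widetilde K,\qquad \mathcal A_\ell\le\widetilde A\,\ell^{-\kappa_2}\quad(\ell\ge1).$$ Write $\widehat W_{\ell,m,0}(s):=\int_{\mathbb S^2}W_\tau(\tau+s)\,\overline{Y_{\ell,m}}\,d\mu$, $s\ge 0$, and for $t>\tau$ put, with Wiener integrals, $$\widehat{U^I}_{\ell,m}(t):=\int_0^{t-\tau}E_\alpha\big(-\lambda_\ell(t-\tau-s)^\alpha\big)\,d\widehat W_{\ell,m,0}(s),\qquad U^I_\ell(t):=\sum_{m=-\ell}^{\ell}\widehat{U^I}_{\ell,m}(t)\,Y_{\ell,m},$$ $$U^I(t):=\sum_{\ell=0}^\infty U^I_\ell(t),\qquad U^I_{\le L}(t):=\sum_{\ell=0}^{L}U^I_\ell(t)\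 \text{ (truncation at degree } L).$$ *Constants.* Let $\widetilde A_{\kappa_2}:=\Big(\widetilde A\big(\tfrac{2}{\kappa_2-2}+\tfrac1{\kappa_2-1}\big)\Big)^{1/2}$; let $M_\alpha:=\Gamma(1+\alpha)^2|2\alpha-1|^{-1}$ for $\alpha\ne\frac12$ and $M_{1/2}:=\Gamma(3/2)^2$; let $$\gamma_\alpha(\kappa_2):=\begin{cases}\kappa_2+2,&\alpha\in(0,\frac12),\\ \kappa_2,&\alpha=\frac12,\\ \kappa_2+\frac2\alpha-2,&\alpha\in(\frac12,1],\end{cases}\qquad \psi^I_\alpha(t):=\begin{cases}\sqrt{1+M_\alpha t^{1-2\alpha}},&\alpha\in(0,\frac12),\\ K(t),&\alpha=\frac12,\\ \sqrt{1+M_\alpha},&\alpha\in(\frac12,1],\end{cases}$$ where $K(t):=\sqrt{1+M_{1/2}(2+\ln t)}$ for $t>1$ and $K(t):=\sqrt{1+2M_{1/2}}$ for $0<t\le1$. *Claim.* For every $t>\tau$ the Wiener integrals above exist and the series $U^I(t)$ converges in $L_2(\Omega\times\mathbb S^2,\mathbb P\otimes\mu)$. For every integer $L\ge1$ and every $t>\tau$,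 the truncation error $$Q^I_L(t):=\big\|U^I(t)-U^I_{\le L}(t)\big\|_{L_2(\Omega\times\mathbb S^2)}=\Big\|\sum_{\ell=L+1}^\infty U^I_\ell(t)\Big\|_{L_2(\Omega\times\mathbb S^2)}$$ satisfies i) if $\tau<t\le\tau+\lambda_L^{-1/\alpha}$, then $Q^I_L(t)\le\widetilde A_{\kappa_2}\,L^{-(\kappa_2+\frac2\alpha-2)/2}$; ii) if $t>\tau+\lambda_L^{-1/\alpha}$, then $Q^I_L(t)\le\psi^I_\alpha(t-\tau)\,\widetilde A_{\kappa_2}\,L^{-\gamma_\alpha(\kappa_2)/2}$. -/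

import Mathlib

open MeasureTheory ProbabilityTheory Filter Set
open scoped ENNReal NNReal Topology InnerProductSpace

namespace SphereDiffusion

noncomputable section

/-! ### The sphere, its normalized surface measure and spherical harmonics -/

/-- The unit sphere `𝕊²` in Euclidean space `ℝ³`. -/
abbrev Sphere2 : Type := Metric.sphere (0 : EuclideanSpace ℝ (Fin 3)) 1

/-- The surface measure of `𝕊²`, normalized to total mass one. -/
def sphereMeasure : Measure Sphere2 :=
  ((volume : Measure (EuclideanSpace ℝ (Fin 3))).toSphere univ)⁻¹ •
    (volume : Measure (EuclideanSpace ℝ (Fin 3))).toSphere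

instance : IsProbabilityMeasure sphereMeasure := by
  have : NeZero (volume : Measure (EuclideanSpace ℝ (Fin 3))).toSphere :=
    ⟨Measure.toSphere_ne_zero _⟩
  unfold sphereMeasure
  infer_instance

/-- The Legendre polynomial `P_ℓ(t) = 2^{-ℓ} (1/ℓ!) d^ℓ/dt^ℓ (t² - 1)^ℓ`. -/
def legendreP (ℓ : ℕ) : Polynomial ℝ :=
  Polynomial.C ((2 ^ ℓ * (ℓ.factorial : ℝ))⁻¹) *
    Polynomial.derivative^[ℓ] ((Polynomial.X ^ 2 - 1) ^ ℓ)

/-- The spherical harmonic `Y_{ℓ,m}` for `0 ≤ m ≤ ℓ`,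
`Y_{ℓ,m} = √((2ℓ+1)(ℓ-m)!/(ℓ+m)!) P_{ℓ,m}(cos θ) e^{imφ}` with
`P_{ℓ,m}(t) = (-1)^m (1-t²)^{m/2} (d^m/dt^m) P_ℓ(t)`.
It is written here in the Euclidean coordinates `x = (sin θ cos φ, sin θ sin φ, cos θ)`, in which
`(1 - cos² θ)^{m/2} e^{imφ} = (sin θ e^{iφ})^m = (x₁ + i x₂)^m`. -/
def harmonicNonneg (ℓ m : ℕ) (x : Sphere2) : ℂ :=
  ((Real.sqrt ((2 * ℓ + 1) * (ℓ - m).factorial / (ℓ + m).factorial) * (-1) ^ m *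
      (Polynomial.derivative^[m] (legendreP ℓ)).eval (x.1 2) : ℝ) : ℂ) *
    ((x.1 0 : ℂ) + Complex.I * (x.1 1 : ℂ)) ^ m

/-- The complex orthonormal spherical harmonics `Y_{ℓ,m}`, `-ℓ ≤ m ≤ ℓ`, as continuous functions,
with `Y_{ℓ,m} = (-1)^m conj Y_{ℓ,-m}` for `m < 0`. -/
def sphericalHarmonic (ℓ : ℕ) (m : ℤ) : C(Sphere2, ℂ) where
  toFun x := if 0 ≤ m then harmonicNonneg ℓ m.natAbs x
    else (-1) ^ m.natAbs * (starRingEnd ℂ) (harmonicNonneg ℓ m.natAbs x)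
  continuous_toFun := by
    have h : Continuous (harmonicNonneg ℓ m.natAbs) := by
      unfold harmonicNonneg
      fun_prop
    split_ifs
    · exact h
    · exact continuous_const.mul (Complex.continuous_conj.comp h)

/-- The eigenvalues `λ_ℓ = ℓ(ℓ+1)` of the negative Laplace-Beltrami operator. -/
def eigenvalue (ℓ : ℕ) : ℝ := ℓ * (ℓ + 1)

/-! ### Time-delayed Brownian motion with values in `L₂(𝕊²)` -/

/-- The real Hilbert space `L₂(𝕊²)`. -/
abbrev L2Sphere : Type := Lp ℝ 2 sphereMeasure

instance : MeasurableSpace L2Sphere := borel _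

instance : BorelSpace L2Sphere := ⟨rfl⟩

/-- `Re Y_{ℓ,m}` as an element of `L₂(𝕊²)`. -/
def reHarmonic (ℓ : ℕ) (m : ℤ) : L2Sphere :=
  ContinuousMap.toLp 2 sphereMeasure ℝ
    ⟨fun x ↦ (sphericalHarmonic ℓ m x).re, by fun_prop⟩

/-- `Im Y_{ℓ,m}` as an element of `L₂(𝕊²)`. -/
def imHarmonic (ℓ : ℕ) (m : ℤ) : L2Sphere :=
  ContinuousMap.toLp 2 sphereMeasure ℝ
    ⟨fun x ↦ (sphericalHarmonic ℓ m x).im, by fun_prop⟩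

/-- The Fourier coefficient `∫ f conj(Y_{ℓ,m}) dμ` of `f ∈ L₂(𝕊²)`. -/
def fourierCoeff (ℓ : ℕ) (m : ℤ) (f : L2Sphere) : ℂ :=
  ∫ x, (f x : ℂ) * (starRingEnd ℂ) (sphericalHarmonic ℓ m x) ∂sphereMeasure

/-- `W` (its values at times `t ≥ τ`) is an `L₂(𝕊²)`-valued time-delayed Brownian motion started
at time `τ`, that is a `Q`-Wiener process on `[τ, ∞)`. -/
structure IsDelayedQWiener {Ω : Type*} [MeasurableSpace Ω] (P : Measure Ω) (τ : ℝ)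
    (Q : L2Sphere →L[ℝ] L2Sphere) (W : ℝ → Ω → L2Sphere) : Prop where
  /-- The covariance operator is self-adjoint and nonnegative. -/
  covariance_pos : Q.IsPositive
  /-- Each `W(t)` is a random element of `L₂(𝕊²)`. -/
  measurable : ∀ t, τ ≤ t → Measurable (W t)
  /-- `W(τ) = 0`. -/
  start : ∀ᵐ ω ∂P, W τ ω = 0
  /-- Continuous trajectories. -/
  continuous : ∀ᵐ ω ∂P, ContinuousOn (fun t ↦ W t ω) (Ici τ)
  /-- Independent increments. -/
  indep : HasIndepIncrements (fun (s : ℝ≥0) ω ↦ W (τ + s) ω) P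
  /-- `W(t) - W(s)` has the normal distribution `N(0, (t - s) Q)` on `L₂(𝕊²)`: every
  `⟨W(t) - W(s), f⟩` is real normal with mean `0` and variance `(t - s) ⟨Q f, f⟩`. -/
  gaussian : ∀ s t, τ ≤ s → s ≤ t → ∀ f : L2Sphere,
    HasLaw (fun ω ↦ ⟪W t ω - W s ω, f⟫_ℝ)
      (gaussianReal 0 (((t - s) * ⟪Q f, f⟫_ℝ).toNNReal)) P

/-- `A` is the angular power spectrum of a `Q`-Wiener process: `A_ℓ ≥ 0` and
`Q Y_{ℓ,m} = A_ℓ Y_{ℓ,m}` for `-ℓ ≤ m ≤ ℓ` (for the real operator `Q` this is the equation for the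
real and for the imaginary part). -/
structure IsAngularPowerSpectrum (Q : L2Sphere →L[ℝ] L2Sphere) (A : ℕ → ℝ) : Prop where
  nonneg : ∀ ℓ, 0 ≤ A ℓ
  map_re : ∀ (ℓ : ℕ) (m : ℤ), -(ℓ : ℤ) ≤ m → m ≤ ℓ →
    Q (reHarmonic ℓ m) = A ℓ • reHarmonic ℓ m
  map_im : ∀ (ℓ : ℕ) (m : ℤ), -(ℓ : ℤ) ≤ m → m ≤ ℓ →
    Q (imHarmonic ℓ m) = A ℓ • imHarmonic ℓ m

/-! ### Wiener integrals of deterministic functions -/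

/-- A step function on `(a, b]`, with value `c i` on the `i`-th interval `(p i, p (i+1)]` of a
partition `a = p 0 ≤ ⋯ ≤ p n = b`. -/
structure StepFunction (a b : ℝ) where
  n : ℕ
  p : Fin (n + 1) → ℝ
  monotone : Monotone p
  first : p 0 = a
  last : p (Fin.last n) = b
  c : Fin n → ℝ

/-- The value of a step function at `u`. -/
def StepFunction.eval {a b : ℝ} (S : StepFunction a b) (u : ℝ) : ℝ :=
  ∑ i : Fin S.n, (Ioc (S.p i.castSucc) (S.p i.succ)).indicator (fun _ ↦ S.c i) u

/-- The integral of a step function against a process `X`. -/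
def StepFunction.integral {Ω : Type*} {a b : ℝ} (S : StepFunction a b) (X : ℝ → Ω → ℂ) (ω : Ω) :
    ℂ :=
  ∑ i : Fin S.n, (S.c i : ℂ) * (X (S.p i.succ) ω - X (S.p i.castSucc) ω)

/-- `Z` is the Wiener integral `∫_a^b g(u) dX(u)`: it is the limit in `L₂(Ω)` of the integrals of
step functions that converge to `g` in `L₂([a, b])`. -/
def IsWienerIntegral {Ω : Type*} [MeasurableSpace Ω] (P : Measure Ω) (X : ℝ → Ω → ℂ) (a b : ℝ)
    (g : ℝ → ℝ) (Z : Lp ℂ 2 P) : Prop :=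
  ∃ S : ℕ → StepFunction a b,
    Tendsto (fun n ↦ eLpNorm (fun u ↦ (S n).eval u - g u) 2 (volume.restrict (Ioc a b)))
      atTop (𝓝 0) ∧
    Tendsto (fun n ↦ eLpNorm (fun ω ↦ (S n).integral X ω - Z ω) 2 P) atTop (𝓝 0)

open Classical in
/-- The Wiener integral `∫_a^b g(u) dX(u)` as an element of `L₂(Ω)` (`0` if there is none). -/
def wienerIntegral {Ω : Type*} [MeasurableSpace Ω] (P : Measure Ω) (X : ℝ → Ω → ℂ) (a b : ℝ)
    (g : ℝ → ℝ) : Lp ℂ 2 P :=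
  if h : ∃ Z, IsWienerIntegral P X a b g Z then h.choose else 0

/-! ### The inhomogeneous solution and its truncation -/

/-- The Mittag-Leffler function `E_α(z) = ∑_k z^k / Γ(αk + 1)` on the real line. -/
def mittagLeffler (α z : ℝ) : ℝ := ∑' k : ℕ, z ^ k / Real.Gamma (α * k + 1)

/-- The Fourier coefficient `Ŵ_{ℓ,m,0}(s)` of `W₀(s) = W_τ(τ + s)`, `s ≥ 0`. -/
def noiseCoeff {Ω : Type*} (τ : ℝ) (W : ℝ → Ω → L2Sphere) (ℓ : ℕ) (m : ℤ) (s : ℝ) (ω : Ω) : ℂ :=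
  fourierCoeff ℓ m (W (τ + s) ω)

/-- The kernel `s ↦ E_α(-λ_ℓ (r - s)^α)`. -/
def kernelML (α : ℝ) (ℓ : ℕ) (r s : ℝ) : ℝ := mittagLeffler α (-eigenvalue ℓ * (r - s) ^ α)

/-- The random coefficient
`Û^I_{ℓ,m}(t) = ∫_0^{t-τ} E_α(-λ_ℓ (t-τ-s)^α) dŴ_{ℓ,m,0}(s)` for `t > τ`. -/
def inhomCoeff {Ω : Type*} [MeasurableSpace Ω] (P : Measure Ω) (α τ : ℝ)
    (W : ℝ → Ω → L2Sphere) (ℓ : ℕ) (m : ℤ) (t : ℝ) : Lp ℂ 2 P :=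
  wienerIntegral P (noiseCoeff τ W ℓ m) 0 (t - τ) (kernelML α ℓ (t - τ))

lemma memLp_tensor {Ω : Type*} [MeasurableSpace Ω] (P : Measure Ω) [IsProbabilityMeasure P]
    (Z : Lp ℂ 2 P) (f : C(Sphere2, ℂ)) :
    MemLp (fun p : Ω × Sphere2 ↦ Z p.1 * f p.2) 2 (P.prod sphereMeasure) := by
  have h1 : MemLp (fun p : Ω × Sphere2 ↦ Z p.1) 2 (P.prod sphereMeasure) :=
    (Lp.memLp Z).comp_fst sphereMeasure
  have h2 : MemLp (fun p : Ω × Sphere2 ↦ f p.2) ∞ (P.prod sphereMeasure) := by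
    refine memLp_top_of_bound
      ((f.continuous.measurable.comp measurable_snd).aestronglyMeasurable) ‖f‖ ?_
    exact Eventually.of_forall fun p ↦ f.norm_coe_le_norm p.2
  exact h2.mul' h1

/-- The random field `(ω, x) ↦ Z(ω) f(x)` in `L₂(Ω × 𝕊²)`. -/
def tensor {Ω : Type*} [MeasurableSpace Ω] (P : Measure Ω) [IsProbabilityMeasure P]
    (Z : Lp ℂ 2 P) (f : C(Sphere2, ℂ)) : Lp ℂ 2 (P.prod sphereMeasure) :=
  (memLp_tensor P Z f).toLp _

/-- The degree-`ℓ` part `U^I_ℓ(t) = ∑_{m=-ℓ}^{ℓ} Û^I_{ℓ,m}(t) Y_{ℓ,m}` of the inhomogeneous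
solution for `t > τ`, and `0` for `t ≤ τ`. -/
def inhomPart {Ω : Type*} [MeasurableSpace Ω] (P : Measure Ω) [IsProbabilityMeasure P] (α τ : ℝ)
    (W : ℝ → Ω → L2Sphere) (ℓ : ℕ) (t : ℝ) : Lp ℂ 2 (P.prod sphereMeasure) :=
  if t ≤ τ then 0
  else ∑ m ∈ Finset.Icc (-(ℓ : ℤ)) ℓ,
    tensor P (inhomCoeff P α τ W ℓ m t) (sphericalHarmonic ℓ m)

/-- The inhomogeneous solution `U^I(t) = ∑_{ℓ=0}^∞ U^I_ℓ(t)`, a series in `L₂(Ω × 𝕊²)`. -/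
def inhomSolution {Ω : Type*} [MeasurableSpace Ω] (P : Measure Ω) [IsProbabilityMeasure P]
    (α τ : ℝ) (W : ℝ → Ω → L2Sphere) (t : ℝ) : Lp ℂ 2 (P.prod sphereMeasure) :=
  ∑' ℓ : ℕ, inhomPart P α τ W ℓ t

/-- The truncated solution `U^I_L(t) = ∑_{ℓ=0}^L U^I_ℓ(t)`. -/
def inhomTruncated {Ω : Type*} [MeasurableSpace Ω] (P : Measure Ω) [IsProbabilityMeasure P]
    (α τ : ℝ) (W : ℝ → Ω → L2Sphere) (L : ℕ) (t : ℝ) : Lp ℂ 2 (P.prod sphereMeasure) :=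
  ∑ ℓ ∈ Finset.range (L + 1), inhomPart P α τ W ℓ t

/-- The truncation error `Q^I_L(t) = ‖U^I(t) - U^I_L(t)‖` in `L₂(Ω × 𝕊²)`. -/
def truncationError {Ω : Type*} [MeasurableSpace Ω] (P : Measure Ω) [IsProbabilityMeasure P]
    (α τ : ℝ) (W : ℝ → Ω → L2Sphere) (L : ℕ) (t : ℝ) : ℝ :=
  ‖inhomSolution P α τ W t - inhomTruncated P α τ W L t‖

/-! ### The constants in the estimate -/

/-- `Ã_κ = (Ã (2/(κ-2) + 1/(κ-1)))^{1/2}`. -/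
def constA (Atilde κ : ℝ) : ℝ := Real.sqrt (Atilde * (2 / (κ - 2) + 1 / (κ - 1)))

/-- `M_α = Γ(1+α)² |2α-1|⁻¹` for `α ≠ 1/2` and `M_{1/2} = Γ(3/2)²`. -/
def constM (α : ℝ) : ℝ :=
  if α = 1 / 2 then Real.Gamma (3 / 2) ^ 2 else Real.Gamma (1 + α) ^ 2 * |2 * α - 1|⁻¹

/-- The exponent `γ_α(κ)`. -/
def gammaExp (α κ : ℝ) : ℝ :=
  if α < 1 / 2 then κ + 2 else if α = 1 / 2 then κ else κ + 2 / α - 2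

/-- The function `K(t)` of the critical case `α = 1/2`. -/
def critK (t : ℝ) : ℝ :=
  if 1 < t then Real.sqrt (1 + constM (1 / 2) * (2 + Real.log t))
  else Real.sqrt (1 + 2 * constM (1 / 2))

/-- The function `ψ^I_α(t)`. -/
def psiI (α t : ℝ) : ℝ :=
  if α < 1 / 2 then Real.sqrt (1 + constM α * t ^ (1 - 2 * α))
  else if α = 1 / 2 then critK t
  else Real.sqrt (1 + constM α)

end

end SphereDiffusion

open SphereDiffusion

namespace SphereDiffusion

/-! ### Legendre polynomials -/

section Legendre

open Polynomial

/-! The error is the norm of an orthogonal series. The spherical harmonics are orthonormal, so the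
terms `tensor P Z Y` of different degree or order are orthogonal in L₂(Ω × 𝕊²), whatever the joint
law of their random coefficients. Itô's isometry gives every coefficient of degree ℓ the same
squared norm, so that ‖U_ℓ(t)‖² = (2ℓ+1) A_ℓ ∫₀^{t-τ} E_α(-λ_ℓ u^α)² du (`norm_inhomPart_sq_eq`). If
these integrals are at most s for all ℓ > L, comparing Σ (2ℓ+1) ℓ^{-κ} with an integral bounds the
squared error by s · constA² · L^{2-κ} (`truncationError_sq_le`).

What remains is to choose s. Since 0 ≤ E_α(-x) ≤ 1, the integral is at most t-τ, which suffices for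
times up to λ_L^{-1/α}. For later times it is split at u = λ_ℓ^{-1/α}. Below this point E_α ≤ 1 is
used, above it E_α(-x) ≤ Γ(1+α)/x. The integral of u^{-2α} is dominated by its upper end for α <
1/2, by its lower end for α > 1/2, and is logarithmic for α = 1/2; hence the three cases of `psiI`
and `gammaExp`.

The bounds on E_α come from a Volterra equation. With k_c(t) = t^{c-1}/Γ(c) and k_a * k_b = k_{a+b},
the series h_b = `relaxation α b` satisfies h_b = k_b - k_α * h_b, and E_α(-t^α) = h_1(t). A
first-zero argument shows h_b > 0 for α ≤ b ≤ 1 (`relaxation_pos`). Positivity of h_α makes h_1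
decreasing and at most 1, and monotonicity of h_1 in its own equation gives the decay.

Orthonormality for different orders follows from rotations about the third axis. For equal orders,
Archimedes' theorem on the height function reduces it to integrals over [-1, 1], which the Legendre
equation evaluates. -/

lemma iterate_derivative_sq_sub_one_pow_ode (ℓ n : ℕ) :
    (X ^ 2 - 1 : ℝ[X]) * derivative^[n + 2] ((X ^ 2 - 1) ^ ℓ)
      + (2 * ((n : ℝ[X]) + 1) - 2 * (ℓ : ℝ[X])) * X * derivative^[n + 1] ((X ^ 2 - 1) ^ ℓ)
      + ((n : ℝ[X]) + 1) * ((n : ℝ[X]) - 2 * (ℓ : ℝ[X])) * derivative^[n] ((X ^ 2 - 1) ^ ℓ) = 0 := by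
  induction n with
  | zero =>
    -- The power y = (X² - 1)^ℓ solves the first-order equation (X² - 1) y' = 2ℓ X y.
    -- Differentiating it once is the base case, and each further derivative is one induction step.
    have h : (X ^ 2 - 1 : ℝ[X]) * derivative ((X ^ 2 - 1) ^ ℓ) =
        2 * (ℓ : ℝ[X]) * X * (X ^ 2 - 1) ^ ℓ := by
      rcases ℓ with _ | ℓ
      · simp
      · rw [derivative_pow_succ]
        simp
        ring
    have h' := congrArg derivative h
    simp only [derivative_mul, derivative_sub, derivative_X_pow, derivative_one, derivative_X,
      derivative_natCast, derivative_ofNat, Nat.cast_ofNat] at h'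
    simp only [Function.iterate_succ, Function.iterate_zero, Function.comp_apply, id_eq,
      Nat.cast_zero]
    simp only [map_ofNat] at h'
    linear_combination h'
  | succ n ih =>
    have h' := congrArg derivative ih
    simp only [derivative_mul, derivative_add, derivative_sub, derivative_X_pow, derivative_one,
      derivative_X, derivative_natCast, derivative_ofNat, Nat.cast_ofNat, derivative_zero,
      ← Function.iterate_succ_apply' derivative, map_ofNat] at h'
    push_cast
    linear_combination h'

/-- Sturm–Liouville form of the Legendre equation differentiated m times: the weight (1 - X²)^m is
the integrating factor. -/
lemma derivative_weight_mul_iterate_derivative_legendreP (ℓ m : ℕ) :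
    derivative ((1 - X ^ 2) ^ (m + 1) * derivative^[m + 1] (legendreP ℓ)) =
      C (-((ℓ - m : ℝ) * (ℓ + m + 1))) * ((1 - X ^ 2) ^ m * derivative^[m] (legendreP ℓ)) := by
  have h := iterate_derivative_sq_sub_one_pow_ode ℓ (m + ℓ)
  have key : ∀ j, derivative^[j] (legendreP ℓ) =
      C ((2 ^ ℓ * (ℓ.factorial : ℝ))⁻¹) * derivative^[j + ℓ] ((X ^ 2 - 1) ^ ℓ) := by
    intro j
    rw [legendreP, iterate_derivative_C_mul, ← Function.iterate_add_apply]
  rw [derivative_mul, ← Function.iterate_succ_apply' derivative, derivative_pow_succ, key, key, key]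
  rw [show m + ℓ + 2 = (m + 1).succ + ℓ by simp; omega, show m + ℓ + 1 = m + 1 + ℓ by omega] at h
  simp only [derivative_one, derivative_X_pow, map_add, map_one, map_natCast, map_neg, map_mul,
    map_sub, Nat.cast_ofNat, map_ofNat] at h ⊢
  push_cast at h
  linear_combination (-C (2 ^ ℓ * (ℓ.factorial : ℝ))⁻¹ * (1 - X ^ 2) ^ m) * h

/-- The integral of a polynomial over `[-1, 1]`. -/
noncomputable def polyIntegral (p : ℝ[X]) : ℝ := ∫ x in (-1 : ℝ)..1, p.eval x

lemma polyIntegral_derivative (p : ℝ[X]) :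
    polyIntegral (derivative p) = p.eval 1 - p.eval (-1) :=
  intervalIntegral.integral_eq_sub_of_hasDerivAt (fun x _ ↦ p.hasDerivAt x)
    ((derivative p).continuous.intervalIntegrable _ _)

lemma polyIntegral_add (p q : ℝ[X]) : polyIntegral (p + q) = polyIntegral p + polyIntegral q := by
  simp only [polyIntegral, eval_add]
  exact intervalIntegral.integral_add (p.continuous.intervalIntegrable _ _)
    (q.continuous.intervalIntegrable _ _)

lemma polyIntegral_C_mul (c : ℝ) (p : ℝ[X]) : polyIntegral (C c * p) = c * polyIntegral p := by
  simp [polyIntegral]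

/-- Integration by parts; the weight vanishes at ±1, so there is no boundary term. -/
lemma polyIntegral_weight_succ (ℓ m : ℕ) (q : ℝ[X]) :
    polyIntegral ((1 - X ^ 2) ^ (m + 1) * derivative^[m + 1] (legendreP ℓ) * derivative q) =
      ((ℓ - m : ℝ) * (ℓ + m + 1)) *
        polyIntegral ((1 - X ^ 2) ^ m * derivative^[m] (legendreP ℓ) * q) := by
  have h := polyIntegral_derivative
    ((1 - X ^ 2) ^ (m + 1) * derivative^[m + 1] (legendreP ℓ) * q)
  rw [derivative_mul, derivative_weight_mul_iterate_derivative_legendreP, mul_assoc,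
    polyIntegral_add, polyIntegral_C_mul] at h
  simp at h
  simp only [← Function.iterate_succ_apply] at h ⊢
  linarith

/-- The Legendre operator is symmetric and its eigenvalues ℓ(ℓ+1) are distinct. -/
lemma polyIntegral_legendreP_mul_eq_zero {ℓ k : ℕ} (h : ℓ ≠ k) :
    polyIntegral (legendreP ℓ * legendreP k) = 0 := by
  have h1 := polyIntegral_weight_succ ℓ 0 (legendreP k)
  have h2 := polyIntegral_weight_succ k 0 (legendreP ℓ)
  simp only [zero_add, pow_one, Function.iterate_one, Function.iterate_zero, id, pow_zero,
    one_mul, Nat.cast_zero, sub_zero, add_zero] at h1 h2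
  rw [mul_right_comm] at h2
  rw [mul_comm (legendreP k) (legendreP ℓ), h1] at h2
  have h3 : ((ℓ : ℝ) * (ℓ + 1) - k * (k + 1)) * polyIntegral (legendreP ℓ * legendreP k) = 0 := by
    linarith
  rcases mul_eq_zero.1 h3 with h3 | h3
  · have h4 : ((ℓ : ℝ) - k) * (ℓ + k + 1) = 0 := by linarith
    rcases mul_eq_zero.1 h4 with h4 | h4
    · exact absurd (by exact_mod_cast sub_eq_zero.1 h4) h
    · exact absurd h4 (by positivity)
  · exact h3

lemma polyIntegral_assocLegendre (ℓ k m : ℕ) (hm : m ≤ ℓ) :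
    polyIntegral ((1 - X ^ 2) ^ m * derivative^[m] (legendreP ℓ) * derivative^[m] (legendreP k)) =
      ((ℓ + m).factorial / (ℓ - m).factorial : ℝ) * polyIntegral (legendreP ℓ * legendreP k) := by
  induction m with
  | zero => simp [Nat.factorial_ne_zero]
  | succ m ih =>
    rw [Function.iterate_succ_apply' derivative m (legendreP k), polyIntegral_weight_succ,
      ih (by omega), ← mul_assoc]
    congr 1
    have h1 : ((ℓ + (m + 1)).factorial : ℝ) = (ℓ + m + 1) * (ℓ + m).factorial := by
      rw [← add_assoc, Nat.factorial_succ]; push_cast; ring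
    have h2 : ((ℓ - m).factorial : ℝ) = (ℓ - m) * (ℓ - (m + 1)).factorial := by
      rw [show ℓ - m = (ℓ - (m + 1)) + 1 by omega, Nat.factorial_succ]
      push_cast [hm]; ring
    have h3 : (ℓ - m : ℝ) ≠ 0 := by
      have : (m + 1 : ℝ) ≤ ℓ := by exact_mod_cast hm
      linarith
    rw [h1, h2]
    field_simp

lemma polyIntegral_one_sub_sq_pow (n : ℕ) :
    polyIntegral ((1 - X ^ 2) ^ n) =
      2 * 4 ^ n * (n.factorial : ℝ) ^ 2 / ((2 * n + 1) * (2 * n).factorial) := by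
  induction n with
  | zero =>
    simp [polyIntegral]
    norm_num
  | succ n ih =>
    -- This polynomial vanishes at ±1, and its derivative combines the integrands for n+1 and n,
    -- which yields the recursion.
    have h := polyIntegral_derivative (X * (1 - X ^ 2) ^ (n + 1) : ℝ[X])
    have e : derivative (X * (1 - X ^ 2) ^ (n + 1) : ℝ[X]) =
        C (2 * n + 3 : ℝ) * (1 - X ^ 2) ^ (n + 1) + C (-(2 * (n + 1)) : ℝ) * (1 - X ^ 2) ^ n := by
      rw [derivative_mul, derivative_pow_succ]
      simp only [derivative_sub, derivative_one, derivative_X_pow, derivative_X, map_add, map_one,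
        map_natCast, map_neg, map_mul, map_ofNat]
      simp
      ring
    rw [e, polyIntegral_add, polyIntegral_C_mul, polyIntegral_C_mul, ih] at h
    simp at h
    have h3 : (2 * n + 3 : ℝ) ≠ 0 := by positivity
    rw [show 2 * (n + 1) = 2 * n + 1 + 1 by ring, Nat.factorial_succ, Nat.factorial_succ,
      Nat.factorial_succ]
    push_cast
    have h4 : (2 * n + 1 : ℝ) ≠ 0 := by positivity
    have h5 : ((2 * n).factorial : ℝ) ≠ 0 := by positivity
    field_simp at h ⊢
    linear_combination (2 * (n + 1) : ℝ) * h

lemma iterate_derivative_self_legendreP (ℓ : ℕ) :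
    derivative^[ℓ] (legendreP ℓ) = C ((2 * ℓ).factorial / (2 ^ ℓ * (ℓ.factorial : ℝ))) := by
  rw [legendreP, iterate_derivative_C_mul, ← Function.iterate_add_apply]
  have hd : ((X ^ 2 - 1 : ℝ[X]) ^ ℓ).natDegree = 2 * ℓ := by
    rw [show (X ^ 2 - 1 : ℝ[X]) = X ^ 2 - C 1 by simp, natDegree_pow, natDegree_X_pow_sub_C,
      mul_comm]
  have hm : ((X ^ 2 - 1 : ℝ[X]) ^ ℓ).Monic := by
    rw [show (X ^ 2 - 1 : ℝ[X]) = X ^ 2 - C 1 by simp]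
    exact (monic_X_pow_sub_C 1 two_ne_zero).pow ℓ
  have h : derivative^[ℓ + ℓ] ((X ^ 2 - 1 : ℝ[X]) ^ ℓ) = C ((2 * ℓ).factorial : ℝ) := by
    have h0 : (derivative^[ℓ + ℓ] ((X ^ 2 - 1 : ℝ[X]) ^ ℓ)).natDegree = 0 := by
      have := natDegree_iterate_derivative ((X ^ 2 - 1 : ℝ[X]) ^ ℓ) (ℓ + ℓ)
      omega
    rw [eq_C_of_natDegree_eq_zero h0, coeff_iterate_derivative, zero_add, ← two_mul,
      Nat.descFactorial_self]
    have := hm.coeff_natDegree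
    rw [hd] at this
    rw [this]
    simp
  rw [h, ← C_mul]
  congr 1
  ring

/-- Taking m = ℓ in `polyIntegral_assocLegendre` replaces both Legendre factors by constants, so
that only the integral of (1 - X²)^ℓ is left. -/
lemma polyIntegral_legendreP_sq (ℓ : ℕ) :
    polyIntegral (legendreP ℓ * legendreP ℓ) = 2 / (2 * ℓ + 1) := by
  have h := polyIntegral_assocLegendre ℓ ℓ ℓ le_rfl
  rw [iterate_derivative_self_legendreP, mul_assoc, ← C_mul, mul_comm, polyIntegral_C_mul,
    polyIntegral_one_sub_sq_pow, ← two_mul] at h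
  simp only [Nat.sub_self, Nat.factorial_zero, Nat.cast_one, div_one] at h
  have h5 : ((2 * ℓ).factorial : ℝ) ≠ 0 := by positivity
  have h4 : (2 * ℓ + 1 : ℝ) ≠ 0 := by positivity
  have h6 : (4 : ℝ) ^ ℓ = (2 ^ ℓ) ^ 2 := by rw [← pow_mul, mul_comm, pow_mul]; norm_num
  rw [h6] at h
  refine mul_left_cancel₀ h5 (h.symm.trans ?_)
  field_simp

end Legendre

/-! ### Integration over the sphere -/

section SphereIntegral

/-- Euclidean space `ℝ³`. -/
abbrev Space : Type := EuclideanSpace ℝ (Fin 3)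

/-- The Gaussian radial moment `∫_0^∞ r^k e^{-r²} dr`. -/
noncomputable def radialMoment (k : ℕ) : ℝ := ∫ r in Ioi (0 : ℝ), r ^ k * Real.exp (-r ^ 2)

lemma radialMoment_eq (k : ℕ) : radialMoment k = 1 / 2 * Real.Gamma ((k + 1) / 2) := by
  rw [← integral_rpow_mul_exp_neg_rpow two_pos (by linarith [(k.cast_nonneg : (0 : ℝ) ≤ k)])]
  refine setIntegral_congr_fun measurableSet_Ioi fun r _ ↦ ?_
  norm_cast

lemma radialMoment_pos (k : ℕ) : 0 < radialMoment k := by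
  rw [radialMoment_eq]
  exact mul_pos (by norm_num) (Real.Gamma_pos_of_pos (by positivity))

lemma radialMoment_add_two (k : ℕ) : radialMoment (k + 2) = (k + 1) / 2 * radialMoment k := by
  rw [radialMoment_eq, radialMoment_eq,
    show (((k + 2 : ℕ) : ℝ) + 1) / 2 = (k + 1) / 2 + 1 by push_cast; ring,
    Real.Gamma_add_one (by positivity)]
  ring

/-- Transfers integrals over the sphere to ℝ³, where Lebesgue measure is invariant under isometries
and the Gaussian weight factors over the coordinates. -/
lemma integral_polar (F : Space → ℂ) (k : ℕ) :
    ∫ x : Space, F (‖x‖⁻¹ • x) * ((‖x‖ ^ k * Real.exp (-‖x‖ ^ 2) : ℝ) : ℂ) =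
      (∫ s, F (s : Space) ∂(volume : Measure Space).toSphere) * (radialMoment (k + 2) : ℂ) := by
  set g : ℝ → ℂ := fun r ↦ ((r ^ k * Real.exp (-r ^ 2) : ℝ) : ℂ) with hg
  have hd : Module.finrank ℝ Space = 3 := by simp
  calc
    ∫ x : Space, F (‖x‖⁻¹ • x) * g ‖x‖
      = ∫ x : ({(0)}ᶜ : Set Space), F (‖x.1‖⁻¹ • x.1) * g ‖x.1‖
          ∂((volume : Measure Space).comap (↑)) := by
      rw [integral_subtype_comap (measurableSet_singleton _).compl
        fun x : Space ↦ F (‖x‖⁻¹ • x) * g ‖x‖, restrict_compl_singleton]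
    _ = ∫ x : Sphere2 × Ioi (0 : ℝ), F x.1 * g x.2
          ∂(volume : Measure Space).toSphere.prod (.volumeIoiPow (Module.finrank ℝ Space - 1)) := by
      simpa using (volume : Measure Space).measurePreserving_homeomorphUnitSphereProd.integral_comp
        (Homeomorph.measurableEmbedding _) (fun x : Sphere2 × Ioi (0 : ℝ) ↦ F x.1 * g x.2)
    _ = (∫ s, F (s : Space) ∂(volume : Measure Space).toSphere) *
          ∫ r : Ioi (0 : ℝ), g r ∂.volumeIoiPow (Module.finrank ℝ Space - 1) :=
      integral_prod_mul (fun s : Sphere2 ↦ F (s : Space)) (fun r : Ioi (0 : ℝ) ↦ g r)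
    _ = _ := by
      congr 1
      simp only [Measure.volumeIoiPow, ENNReal.ofReal, hd]
      rw [integral_withDensity_eq_integral_smul,
        integral_subtype_comap measurableSet_Ioi fun a ↦ Real.toNNReal (a ^ (3 - 1)) • g a,
        radialMoment, ← integral_complex_ofReal]
      · refine setIntegral_congr_fun measurableSet_Ioi fun r hr ↦ ?_
        simp only [NNReal.smul_def, Real.coe_toNNReal _ (pow_nonneg (le_of_lt hr) _), hg,
          Complex.real_smul, ← Complex.ofReal_mul]
        congr 1
        ring
      · exact (measurable_subtype_coe.pow_const _).real_toNNReal

/-- A function on the sphere which is multiplied by `c ≠ 1` under an isometry has integral `0`. -/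
lemma integral_sphere_eq_zero_of_isometry (F : Space → ℂ) (T : Space ≃ₗᵢ[ℝ] Space) (c : ℂ)
    (hc : c ≠ 1) (hF : ∀ x, F (T x) = c * F x) : ∫ s, F (s : Space) ∂sphereMeasure = 0 := by
  have h1 := integral_polar F 0
  have h2 := T.measurePreserving.integral_comp T.toHomeomorph.measurableEmbedding
    (fun x : Space ↦ F (‖x‖⁻¹ • x) * ((‖x‖ ^ 0 * Real.exp (-‖x‖ ^ 2) : ℝ) : ℂ))
  simp only [LinearIsometryEquiv.norm_map, ← map_smul, hF, mul_assoc] at h2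
  rw [integral_const_mul, h1] at h2
  have h3 : (radialMoment (0 + 2) : ℂ) ≠ 0 := by exact_mod_cast (radialMoment_pos _).ne'
  have h4 : (c - 1) * (∫ s, F (s : Space) ∂(volume : Measure Space).toSphere) = 0 := by
    apply mul_right_cancel₀ h3
    linear_combination h2
  have h5 := (mul_eq_zero.1 h4).resolve_left (sub_ne_zero.2 hc)
  rw [sphereMeasure, integral_smul_measure, h5, smul_zero]

lemma integral_gaussian_moment (k : ℕ) :
    ∫ x : Space, ((x 2 ^ k * Real.exp (-‖x‖ ^ 2) : ℝ) : ℂ) =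
      ((Real.pi * ∫ t : ℝ, t ^ k * Real.exp (-t ^ 2) : ℝ) : ℂ) := by
  rw [integral_complex_ofReal]
  congr 1
  rw [← (PiLp.volume_preserving_toLp (Fin 3)).integral_comp
    (MeasurableEquiv.toLp 2 _).measurableEmbedding]
  have h := integral_fintype_prod_volume_eq_prod (ι := Fin 3)
    (f := fun i (t : ℝ) ↦ (if i = 2 then t ^ k else 1) * Real.exp (-t ^ 2))
  have h0 := integral_gaussian 1
  simp only [neg_mul, one_mul, div_one] at h0
  simp only [Fin.prod_univ_three, Fin.isValue, Fin.reduceEq, if_false, one_mul, if_true, h0,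
    Real.mul_self_sqrt Real.pi_pos.le] at h
  rw [← h]
  refine integral_congr_ae (.of_forall fun x ↦ ?_)
  simp only [EuclideanSpace.norm_eq, Real.norm_eq_abs, sq_abs, Fin.sum_univ_three]
  rw [Real.sq_sqrt (by positivity), neg_add, neg_add, Real.exp_add, Real.exp_add]
  ring

/-- The Gaussian moment of x₂^k is computed twice, in polar and in Cartesian coordinates. The radial
moments then cancel through `radialMoment_add_two`. The case k = 0 is the area 4π. -/
lemma integral_toSphere_pow_even (k : ℕ) (hk : Even k) :
    ∫ s, (((s : Space) 2 ^ k : ℝ) : ℂ) ∂(volume : Measure Space).toSphere =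
      ((4 * Real.pi / (k + 1) : ℝ) : ℂ) := by
  have h1 := integral_polar (fun x ↦ ((x 2 ^ k : ℝ) : ℂ)) k
  have h2 : ∫ x : Space, (((‖x‖⁻¹ • x) 2 ^ k : ℝ) : ℂ) *
      ((‖x‖ ^ k * Real.exp (-‖x‖ ^ 2) : ℝ) : ℂ) =
      ∫ x : Space, ((x 2 ^ k * Real.exp (-‖x‖ ^ 2) : ℝ) : ℂ) := by
    refine integral_congr_ae ?_
    have : ∀ᵐ x : Space, x ≠ 0 := by simp [ae_iff]
    filter_upwards [this] with x hx
    rw [← Complex.ofReal_mul]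
    congr 1
    have : ‖x‖ ≠ 0 := norm_ne_zero_iff.2 hx
    simp only [PiLp.smul_apply, smul_eq_mul]
    rw [← mul_assoc, ← mul_pow, inv_mul_eq_div, div_mul_cancel₀ _ this]
  have h3 : ∫ t : ℝ, t ^ k * Real.exp (-t ^ 2) = 2 * radialMoment k := by
    rw [radialMoment, ← integral_comp_abs (f := fun t ↦ t ^ k * Real.exp (-t ^ 2))]
    simp [hk.pow_abs]
  rw [h2, integral_gaussian_moment, h3, radialMoment_add_two] at h1
  have h4 : ((((k + 1) / 2 * radialMoment k : ℝ)) : ℂ) ≠ 0 := by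
    exact_mod_cast (mul_pos (by positivity) (radialMoment_pos k)).ne'
  apply mul_right_cancel₀ h4
  rw [← h1, ← Complex.ofReal_mul]
  congr 1
  field_simp
  ring

lemma toSphere_univ_toReal : ((volume : Measure Space).toSphere univ).toReal = 4 * Real.pi := by
  have h := integral_toSphere_pow_even 0 (by simp)
  simp only [pow_zero, Complex.ofReal_one, integral_const, Complex.real_smul, mul_one,
    Nat.cast_zero, zero_add, div_one] at h
  exact_mod_cast h

lemma integral_sphere_pow (k : ℕ) :
    ∫ s : Sphere2, (((s : Space) 2 ^ k : ℝ) : ℂ) ∂sphereMeasure =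
      ((polyIntegral (Polynomial.X ^ k) / 2 : ℝ) : ℂ) := by
  rcases Nat.even_or_odd k with hk | hk
  · rw [sphereMeasure, integral_smul_measure, integral_toSphere_pow_even k hk, ENNReal.toReal_inv,
      toSphere_univ_toReal, Complex.real_smul, ← Complex.ofReal_mul]
    congr 1
    simp only [polyIntegral, Polynomial.eval_pow, Polynomial.eval_X, integral_pow, one_pow,
      hk.add_one.neg_one_pow]
    have := Real.pi_pos.ne'
    field_simp
    norm_num
  · rw [integral_sphere_eq_zero_of_isometry (fun x ↦ ((x 2 ^ k : ℝ) : ℂ))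
      (LinearIsometryEquiv.neg ℝ) (-1) (by norm_num) (fun x ↦ by simp [hk.neg_pow])]
    simp [polyIntegral, integral_pow, hk.add_one.neg_one_pow]

lemma integrable_sphere_continuous {E : Type*} [NormedAddCommGroup E] {f : Sphere2 → E}
    [SecondCountableTopology E] (hf : Continuous f) : Integrable f sphereMeasure :=
  hf.integrable_of_hasCompactSupport (HasCompactSupport.of_compactSpace f)

/-- Archimedes: the height function is uniformly distributed on `[-1, 1]`. -/
lemma integral_sphere_poly (q : Polynomial ℝ) :
    ∫ s : Sphere2, ((q.eval ((s : Space) 2) : ℝ) : ℂ) ∂sphereMeasure =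
      ((polyIntegral q / 2 : ℝ) : ℂ) := by
  have hc : ∀ q : Polynomial ℝ, Continuous fun s : Sphere2 ↦ ((q.eval ((s : Space) 2) : ℝ) : ℂ) :=
    fun q ↦ Complex.continuous_ofReal.comp (q.continuous.comp (by fun_prop))
  induction q using Polynomial.induction_on' with
  | add p q hp hq =>
    simp only [Polynomial.eval_add, Complex.ofReal_add]
    rw [integral_add (integrable_sphere_continuous (hc p)) (integrable_sphere_continuous (hc q)),
      hp, hq, polyIntegral_add]
    push_cast
    ring
  | monomial n a =>
    rw [← Polynomial.C_mul_X_pow_eq_monomial, polyIntegral_C_mul]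
    simp only [Polynomial.eval_mul, Polynomial.eval_C, Polynomial.eval_pow, Polynomial.eval_X,
      Complex.ofReal_mul]
    rw [integral_const_mul]
    have := integral_sphere_pow n
    simp only [Complex.ofReal_pow] at this ⊢
    rw [this]
    push_cast
    ring

end SphereIntegral

/-! ### Orthonormality of the spherical harmonics -/

section Orthonormality

/-- The rotation by `θ` about the third axis, as a linear map. -/
noncomputable def rotationMap (θ : ℝ) : Space →ₗ[ℝ] Space where
  toFun x := !₂[Real.cos θ * x 0 - Real.sin θ * x 1, Real.sin θ * x 0 + Real.cos θ * x 1, x 2]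
  map_add' x y := by ext i; fin_cases i <;> simp <;> ring
  map_smul' c x := by ext i; fin_cases i <;> simp <;> ring

/-- The rotation by `θ` about the third axis. -/
noncomputable def rotation (θ : ℝ) : Space ≃ₗᵢ[ℝ] Space :=
  LinearIsometry.toLinearIsometryEquiv
    { rotationMap θ with
      norm_map' := fun x ↦ by
        rw [EuclideanSpace.norm_eq, EuclideanSpace.norm_eq]
        congr 1
        simp only [Fin.sum_univ_three, Real.norm_eq_abs, sq_abs]
        simp [rotationMap]
        linear_combination (x 0 ^ 2 + x 1 ^ 2) * Real.sin_sq_add_cos_sq θ } rfl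

lemma rotation_apply (θ : ℝ) (x : Space) : rotation θ x =
    !₂[Real.cos θ * x 0 - Real.sin θ * x 1, Real.sin θ * x 0 + Real.cos θ * x 1, x 2] := rfl

/-- The extension of `harmonicNonneg` to `ℝ³` given by the same formula. -/
noncomputable def harmonicNonnegExt (ℓ m : ℕ) (x : Space) : ℂ :=
  ((Real.sqrt ((2 * ℓ + 1) * (ℓ - m).factorial / (ℓ + m).factorial) * (-1) ^ m *
      (Polynomial.derivative^[m] (legendreP ℓ)).eval (x 2) : ℝ) : ℂ) *
    ((x 0 : ℂ) + Complex.I * (x 1 : ℂ)) ^ m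

/-- The extension of `sphericalHarmonic` to `ℝ³` given by the same formula. -/
noncomputable def harmonicExt (ℓ : ℕ) (m : ℤ) (x : Space) : ℂ :=
  if 0 ≤ m then harmonicNonnegExt ℓ m.natAbs x
    else (-1) ^ m.natAbs * (starRingEnd ℂ) (harmonicNonnegExt ℓ m.natAbs x)

lemma harmonicNonnegExt_rotation (ℓ m : ℕ) (θ : ℝ) (x : Space) :
    harmonicNonnegExt ℓ m (rotation θ x) =
      Complex.exp (m * (θ * Complex.I)) * harmonicNonnegExt ℓ m x := by
  have : ((rotation θ x 0 : ℝ) : ℂ) + Complex.I * (rotation θ x 1 : ℝ) =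
      Complex.exp (θ * Complex.I) * (x 0 + Complex.I * x 1) := by
    rw [rotation_apply, Complex.exp_mul_I]
    simp
    linear_combination (-(Complex.sin θ) * x 1) * Complex.I_sq
  rw [harmonicNonnegExt, harmonicNonnegExt, this, mul_pow, ← Complex.exp_nat_mul]
  have h2 : rotation θ x 2 = x 2 := rfl
  rw [h2]
  ring

lemma harmonicExt_rotation (ℓ : ℕ) (m : ℤ) (θ : ℝ) (x : Space) :
    harmonicExt ℓ m (rotation θ x) = Complex.exp (m * (θ * Complex.I)) * harmonicExt ℓ m x := by
  unfold harmonicExt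
  split_ifs with h
  · rw [harmonicNonnegExt_rotation]
    congr 2
    rw [show ((m.natAbs : ℕ) : ℂ) = ((m.natAbs : ℤ) : ℂ) by simp, Int.natAbs_of_nonneg h]
  · rw [harmonicNonnegExt_rotation, map_mul, ← Complex.exp_conj]
    have : (starRingEnd ℂ) (m.natAbs * (θ * Complex.I)) = m * (θ * Complex.I) := by
      rw [show ((m.natAbs : ℕ) : ℂ) = ((m.natAbs : ℤ) : ℂ) by simp,
        Int.ofNat_natAbs_of_nonpos (by omega)]
      simp
    rw [this]
    ring

lemma integral_harmonic_eq_zero_of_order_ne (ℓ k : ℕ) {m n : ℤ} (h : m ≠ n) :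
    ∫ s, sphericalHarmonic ℓ m s * (starRingEnd ℂ) (sphericalHarmonic k n s) ∂sphereMeasure
      = 0 := by
  have hmn : ((m : ℂ) - n) ≠ 0 := by exact_mod_cast sub_ne_zero.2 h
  -- Rotation by θ multiplies the product by e^{i(m-n)θ}; θ = π/(m-n) makes this factor -1.
  refine integral_sphere_eq_zero_of_isometry
    (fun x ↦ harmonicExt ℓ m x * (starRingEnd ℂ) (harmonicExt k n x))
    (rotation (Real.pi / (m - n))) (-1) (by norm_num) fun x ↦ ?_
  simp only [harmonicExt_rotation, map_mul, ← Complex.exp_conj, Complex.conj_ofReal, Complex.conj_I,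
    map_intCast]
  have : Complex.exp (m * (((Real.pi / (m - n) : ℝ) : ℂ) * Complex.I)) *
      Complex.exp (n * (((Real.pi / (m - n) : ℝ) : ℂ) * -Complex.I)) = -1 := by
    rw [← Complex.exp_add, ← Complex.exp_pi_mul_I]
    congr 1
    push_cast
    field_simp
    ring
  linear_combination (harmonicExt ℓ m x * (starRingEnd ℂ) (harmonicExt k n x)) * this

lemma harmonicNonneg_mul_conj (ℓ k m : ℕ) (s : Sphere2) :
    harmonicNonneg ℓ m s * (starRingEnd ℂ) (harmonicNonneg k m s) =
      ((Real.sqrt ((2 * ℓ + 1) * (ℓ - m).factorial / (ℓ + m).factorial) *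
        Real.sqrt ((2 * k + 1) * (k - m).factorial / (k + m).factorial) : ℝ) : ℂ) *
      (((((1 - Polynomial.X ^ 2) ^ m * Polynomial.derivative^[m] (legendreP ℓ) *
        Polynomial.derivative^[m] (legendreP k)).eval (s.1 2)) : ℝ) : ℂ) := by
  have hs : (s.1 0) ^ 2 + (s.1 1) ^ 2 = 1 - (s.1 2) ^ 2 := by
    have h := s.2
    rw [mem_sphere_zero_iff_norm, EuclideanSpace.norm_eq, Real.sqrt_eq_one] at h
    simp only [Fin.sum_univ_three, Real.norm_eq_abs, sq_abs] at h
    linarith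
  have hw : ((s.1 0 : ℂ) + Complex.I * s.1 1) *
      (starRingEnd ℂ) ((s.1 0 : ℂ) + Complex.I * s.1 1) = ((1 - (s.1 2) ^ 2 : ℝ) : ℂ) := by
    rw [← hs]
    simp
    linear_combination (-(s.1 1 : ℂ) ^ 2) * Complex.I_sq
  have hp := congrArg (· ^ m) hw
  simp only [mul_pow] at hp
  have h1 : ((-1 : ℂ) ^ m) * (-1) ^ m = 1 := by rw [← mul_pow]; simp
  simp only [harmonicNonneg, map_mul, Complex.conj_ofReal, map_pow, Polynomial.eval_mul,
    Polynomial.eval_pow, Polynomial.eval_sub, Polynomial.eval_one, Polynomial.eval_X,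
    Complex.ofReal_mul, Complex.ofReal_pow] at hp ⊢
  rw [← hp]
  push_cast
  linear_combination (((Real.sqrt ((2 * ℓ + 1) * (ℓ - m).factorial / (ℓ + m).factorial) : ℝ) : ℂ) *
        ((Real.sqrt ((2 * k + 1) * (k - m).factorial / (k + m).factorial) : ℝ) : ℂ) *
        (((Polynomial.derivative^[m] (legendreP ℓ)).eval (s.1 2) : ℝ) : ℂ) *
        (((Polynomial.derivative^[m] (legendreP k)).eval (s.1 2) : ℝ) : ℂ) *
        ((s.1 0 : ℂ) + Complex.I * s.1 1) ^ m *
        ((starRingEnd ℂ) ((s.1 0 : ℂ) + Complex.I * s.1 1)) ^ m) * h1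

/-- For equal orders the product is real by `harmonicNonneg_mul_conj`, so the conjugation in the
definition for m < 0 has no effect and the two signs cancel. -/
lemma sphericalHarmonic_mul_conj (ℓ k : ℕ) (m : ℤ) (s : Sphere2) :
    sphericalHarmonic ℓ m s * (starRingEnd ℂ) (sphericalHarmonic k m s) =
      harmonicNonneg ℓ m.natAbs s * (starRingEnd ℂ) (harmonicNonneg k m.natAbs s) := by
  change (if _ then _ else _) * (starRingEnd ℂ) (if _ then _ else _) = _
  split_ifs
  · rfl
  · have h1 : ((-1 : ℂ) ^ m.natAbs) * (-1) ^ m.natAbs = 1 := by rw [← mul_pow]; simp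
    have h2 := harmonicNonneg_mul_conj ℓ k m.natAbs s
    have h3 := congrArg (starRingEnd ℂ) h2
    rw [map_mul _ ((Real.sqrt _ * Real.sqrt _ : ℝ) : ℂ), Complex.conj_ofReal, Complex.conj_ofReal,
      ← h2] at h3
    simp only [map_mul, map_pow, map_neg, map_one, Complex.conj_conj] at h3 ⊢
    linear_combination h3 + (starRingEnd ℂ) (harmonicNonneg ℓ m.natAbs s) *
      (harmonicNonneg k m.natAbs s) * h1

theorem integral_sphericalHarmonic_mul_conj (ℓ k : ℕ) (m n : ℤ) (hm : m.natAbs ≤ ℓ) :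
    ∫ s, sphericalHarmonic ℓ m s * (starRingEnd ℂ) (sphericalHarmonic k n s) ∂sphereMeasure
      = if ℓ = k ∧ m = n then 1 else 0 := by
  by_cases hmn : m = n
  · subst hmn
    simp only [sphericalHarmonic_mul_conj, harmonicNonneg_mul_conj]
    rw [integral_const_mul, integral_sphere_poly, polyIntegral_assocLegendre _ _ _ hm]
    by_cases hk : ℓ = k
    · subst hk
      rw [polyIntegral_legendreP_sq, if_pos (by simp), ← Complex.ofReal_mul,
        Real.mul_self_sqrt (by positivity), ← Complex.ofReal_one]
      congr 1
      have h1 : ((ℓ + m.natAbs).factorial : ℝ) ≠ 0 := by positivity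
      have h2 : ((ℓ - m.natAbs).factorial : ℝ) ≠ 0 := by positivity
      field_simp
    · rw [polyIntegral_legendreP_mul_eq_zero hk, if_neg (by tauto)]
      simp
  · rw [integral_harmonic_eq_zero_of_order_ne _ _ hmn, if_neg (by tauto)]

end Orthonormality

/-! ### Mittag-Leffler functions -/

section MittagLeffler

/-- The kernel `t^{c-1} / Γ(c)` of fractional integration of order `c`. -/
noncomputable def fracKernel (c t : ℝ) : ℝ := t ^ (c - 1) / Real.Gamma c

lemma fracKernel_pos {c t : ℝ} (hc : 0 < c) (ht : 0 < t) : 0 < fracKernel c t :=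
  div_pos (Real.rpow_pos_of_pos ht _) (Real.Gamma_pos_of_pos hc)

lemma fracKernel_nonneg {c t : ℝ} (hc : 0 < c) (ht : 0 ≤ t) : 0 ≤ fracKernel c t :=
  div_nonneg (Real.rpow_nonneg ht _) (Real.Gamma_pos_of_pos hc).le

lemma fracKernel_one (t : ℝ) : fracKernel 1 t = 1 := by simp [fracKernel]

lemma continuousOn_fracKernel (c : ℝ) : ContinuousOn (fracKernel c) (Ioi 0) := by
  intro t ht
  exact ((Real.continuousAt_rpow_const t _ (.inl (ne_of_gt ht))).div_const _).continuousWithinAt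

lemma integral_fracKernel_mul {b c t : ℝ} (hb : 0 < b) (hc : 0 < c) (ht : 0 < t) :
    ∫ s in (0 : ℝ)..t, fracKernel c (t - s) * fracKernel b s = fracKernel (b + c) t := by
  have h1 := Complex.betaIntegral_scaled (b : ℂ) (c : ℂ) ht
  have h2 : ∫ x in (0 : ℝ)..t, (x : ℂ) ^ ((b : ℂ) - 1) * ((t : ℂ) - x) ^ ((c : ℂ) - 1) =
      ((∫ x in (0 : ℝ)..t, x ^ (b - 1) * (t - x) ^ (c - 1) : ℝ) : ℂ) := by
    rw [← intervalIntegral.integral_ofReal]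
    refine intervalIntegral.integral_congr_uIoo fun x hx ↦ ?_
    rw [uIoo_of_le ht.le] at hx
    rw [Complex.ofReal_mul, Complex.ofReal_cpow hx.1.le, Complex.ofReal_cpow (by linarith [hx.2])]
    push_cast
    rfl
  rw [h2] at h1
  have h3 := congrArg Complex.re h1
  rw [show (t : ℂ) ^ ((b : ℂ) + c - 1) = ((t ^ (b + c - 1) : ℝ) : ℂ) by
      rw [Complex.ofReal_cpow ht.le]; push_cast; rfl, Complex.ofReal_re, Complex.re_ofReal_mul,
    ← beta_eq_betaIntegralReal b c hb hc, beta] at h3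
  have h4 : ∀ s, fracKernel c (t - s) * fracKernel b s =
      (Real.Gamma b * Real.Gamma c)⁻¹ * (s ^ (b - 1) * (t - s) ^ (c - 1)) := by
    intro s
    rw [fracKernel, fracKernel]
    field_simp
  simp only [h4]
  rw [intervalIntegral.integral_const_mul, h3, fracKernel]
  have := (Real.Gamma_pos_of_pos hb).ne'
  have := (Real.Gamma_pos_of_pos hc).ne'
  field_simp

lemma intervalIntegrable_fracKernel_mul {b c t : ℝ} (hb : 0 < b) (hc : 0 < c) (ht : 0 < t) :
    IntervalIntegrable (fun s ↦ fracKernel c (t - s) * fracKernel b s) volume 0 t := by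
  -- A non-integrable function has integral 0 by convention, whereas the Beta integral is positive.
  by_contra h
  have h1 := integral_fracKernel_mul hb hc ht
  rw [intervalIntegral.integral_undef h] at h1
  exact (fracKernel_pos (by linarith : 0 < b + c) ht).ne h1

/-- Only the part x > R of the Gamma integral is kept, where x^y ≥ R^y. -/
lemma rpow_mul_exp_neg_le_Gamma {y R : ℝ} (hy : 0 ≤ y) (hR : 0 < R) :
    R ^ y * Real.exp (-R) ≤ Real.Gamma (y + 1) := by
  rw [Real.Gamma_eq_integral (by linarith), ← integral_exp_neg_Ioi, ← integral_const_mul]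
  have hi := Real.GammaIntegral_convergent (s := y + 1) (by linarith)
  calc ∫ x in Ioi R, R ^ y * Real.exp (-x)
      ≤ ∫ x in Ioi R, Real.exp (-x) * x ^ (y + 1 - 1) := by
        refine setIntegral_mono_on ((integrableOn_exp_neg_Ioi R).const_mul _)
          (hi.mono_set (Ioi_subset_Ioi hR.le)) measurableSet_Ioi fun x hx ↦ ?_
        rw [mul_comm, add_sub_cancel_right]
        gcongr
        exact le_of_lt hx
    _ ≤ ∫ x in Ioi 0, Real.exp (-x) * x ^ (y + 1 - 1) := by
        refine setIntegral_mono_set hi ?_ (Ioi_subset_Ioi hR.le).eventuallyLE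
        filter_upwards [ae_restrict_mem measurableSet_Ioi] with x hx
        exact mul_nonneg (Real.exp_pos _).le (Real.rpow_nonneg (le_of_lt hx) _)

lemma fracKernel_le {y t T : ℝ} (hy : 0 < y) (ht : 0 < t) (hT : t ≤ T) :
    fracKernel y t ≤ Real.exp (2 * T) / t * (y * (1 / 2) ^ y) := by
  have hT0 : 0 < T := ht.trans_le hT
  -- The choice R = 2T leaves the geometric factor (1/2)^y, which makes the series over y = αj + b
  -- converge uniformly for t in compact subsets of (0, ∞).
  have h1 := rpow_mul_exp_neg_le_Gamma hy.le (R := 2 * T) (by positivity)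
  have h2 : fracKernel y t = y * t ^ y / t / Real.Gamma (y + 1) := by
    rw [fracKernel, Real.Gamma_add_one hy.ne', Real.rpow_sub_one ht.ne']
    field_simp
  rw [h2, div_le_iff₀ (Real.Gamma_pos_of_pos (by linarith))]
  calc y * t ^ y / t ≤ y * T ^ y / t := by gcongr
    _ = Real.exp (2 * T) / t * (y * (1 / 2) ^ y) * ((2 * T) ^ y * Real.exp (-(2 * T))) := by
      rw [Real.mul_rpow two_pos.le hT0.le, Real.exp_neg, one_div, Real.inv_rpow two_pos.le]
      have : (2 : ℝ) ^ y ≠ 0 := (Real.rpow_pos_of_pos two_pos _).ne'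
      field_simp
    _ ≤ _ := by gcongr

variable {α : ℝ}

lemma summable_mul_half_rpow (hα : 0 < α) (b : ℝ) :
    Summable fun j : ℕ ↦ (α * j + b) * (1 / 2 : ℝ) ^ (α * j + b) := by
  have hr : ‖((1 / 2 : ℝ) ^ α)‖ < 1 := by
    rw [Real.norm_of_nonneg (by positivity)]
    exact Real.rpow_lt_one (by norm_num) (by norm_num) hα
  have h1 := (summable_pow_mul_geometric_of_norm_lt_one 1 hr).mul_left (α * (1 / 2 : ℝ) ^ b)
  have h0 := (summable_geometric_of_norm_lt_one hr).mul_left (b * (1 / 2 : ℝ) ^ b)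
  refine (h1.add h0).congr fun j ↦ ?_
  rw [Real.rpow_add (by norm_num), Real.rpow_mul (by norm_num), Real.rpow_natCast]
  ring

lemma summable_fracKernel (hα : 0 < α) {b t : ℝ} (hb : 0 < b) (ht : 0 < t) :
    Summable fun j : ℕ ↦ fracKernel (α * j + b) t :=
  Summable.of_nonneg_of_le (fun j ↦ fracKernel_nonneg (by positivity) ht.le)
    (fun j ↦ fracKernel_le (by positivity) ht le_rfl) ((summable_mul_half_rpow hα b).mul_left _)

/-- The function `∑_j (-1)^j t^{αj+b-1} / Γ(αj+b) = t^{b-1} E_{α,b}(-t^α)`. -/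
noncomputable def relaxation (α b t : ℝ) : ℝ := ∑' j : ℕ, (-1) ^ j * fracKernel (α * j + b) t

lemma summable_relaxation (hα : 0 < α) {b t : ℝ} (hb : 0 < b) (ht : 0 < t) :
    Summable fun j : ℕ ↦ (-1) ^ j * fracKernel (α * j + b) t := by
  refine Summable.of_norm_bounded (summable_fracKernel hα hb ht) fun j ↦ ?_
  rw [norm_mul, norm_pow, norm_neg, norm_one, one_pow, one_mul,
    Real.norm_of_nonneg (fracKernel_nonneg (by positivity) ht.le)]

lemma continuousOn_relaxation (hα : 0 < α) {b : ℝ} (hb : 0 < b) :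
    ContinuousOn (relaxation α b) (Ioi 0) := by
  intro t (ht : 0 < t)
  refine ContinuousAt.continuousWithinAt ?_
  have hs : Ioo (t / 2) (2 * t) ∈ 𝓝 t := Ioo_mem_nhds (by linarith) (by linarith)
  refine ContinuousOn.continuousAt (s := Ioo (t / 2) (2 * t)) ?_ hs
  refine continuousOn_tsum (u := fun j : ℕ ↦ Real.exp (2 * (2 * t)) / (t / 2) *
    ((α * j + b) * (1 / 2 : ℝ) ^ (α * j + b))) (fun j ↦ ?_)
    ((summable_mul_half_rpow hα b).mul_left _) fun j x hx ↦ ?_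
  · refine continuousOn_const.mul ((continuousOn_fracKernel _).mono fun x hx ↦ ?_)
    exact (half_pos ht).trans hx.1
  · have hx0 : 0 < x := (half_pos ht).trans hx.1
    rw [norm_mul, norm_pow, norm_neg, norm_one, one_pow, one_mul,
      Real.norm_of_nonneg (fracKernel_nonneg (by positivity) hx0.le)]
    refine (fracKernel_le (by positivity) hx0 hx.2.le).trans ?_
    gcongr
    exact hx.1.le

/-- Splits off the term j = 0. Together with `integral_fracKernel_mul_relaxation` for c = α this is
the Volterra equation h_b = k_b - k_α * h_b. -/
lemma relaxation_eq_sub (hα : 0 < α) {b t : ℝ} (hb : 0 < b) (ht : 0 < t) :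
    relaxation α b t = fracKernel b t - relaxation α (b + α) t := by
  rw [relaxation, (summable_relaxation hα hb ht).tsum_eq_zero_add, sub_eq_add_neg, relaxation,
    ← tsum_neg]
  congr 1
  · simp
  · refine tsum_congr fun j ↦ ?_
    rw [show α * ((j + 1 : ℕ) : ℝ) + b = α * j + (b + α) by push_cast; ring]
    ring

lemma abs_relaxation_le (hα : 0 < α) {b : ℝ} (hb : 0 < b) {T : ℝ} (hT : 0 < T) :
    ∃ C, 0 < C ∧ ∀ t, 0 < t → t ≤ T → |relaxation α b t| ≤ C * fracKernel b t := by
  refine ⟨T ^ (1 - b) * Real.Gamma b * ∑' j : ℕ, fracKernel (α * j + b) T, ?_, fun t ht htT ↦ ?_⟩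
  · have h := (summable_fracKernel hα hb hT).tsum_pos
      (fun j ↦ fracKernel_nonneg (by positivity) hT.le) 0 (fracKernel_pos (by simpa) hT)
    have := Real.Gamma_pos_of_pos hb
    positivity
  · have h1 : ∀ j : ℕ, fracKernel (α * j + b) t ≤
        (t / T) ^ (b - 1) * fracKernel (α * j + b) T := by
      intro j
      have hG : 0 < Real.Gamma (α * j + b) := Real.Gamma_pos_of_pos (by positivity)
      rw [fracKernel, fracKernel, ← mul_div_assoc]
      gcongr
      rw [Real.div_rpow ht.le hT.le, add_sub_assoc, Real.rpow_add ht, Real.rpow_add hT]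
      have : 0 < T ^ (b - 1) := Real.rpow_pos_of_pos hT _
      have h3 : t ^ (α * j) ≤ T ^ (α * (j : ℝ)) := by gcongr
      calc t ^ (α * (j : ℝ)) * t ^ (b - 1) ≤ T ^ (α * (j : ℝ)) * t ^ (b - 1) := by gcongr
        _ = _ := by field_simp
    calc |relaxation α b t| ≤ ∑' j : ℕ, fracKernel (α * j + b) t := by
          rw [← Real.norm_eq_abs]
          refine tsum_of_norm_bounded (summable_fracKernel hα hb ht).hasSum fun j ↦ ?_
          rw [norm_mul, norm_pow, norm_neg, norm_one, one_pow, one_mul,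
            Real.norm_of_nonneg (fracKernel_nonneg (by positivity) ht.le)]
      _ ≤ ∑' j : ℕ, (t / T) ^ (b - 1) * fracKernel (α * j + b) T :=
          (summable_fracKernel hα hb ht).tsum_le_tsum h1
            ((summable_fracKernel hα hb hT).mul_left _)
      _ = _ := by
          rw [tsum_mul_left, fracKernel, Real.div_rpow ht.le hT.le,
            show (1 - b) = -(b - 1) by ring, Real.rpow_neg hT.le]
          have := (Real.Gamma_pos_of_pos hb).ne'
          field_simp

lemma intervalIntegrable_fracKernel_mul_relaxation (hα : 0 < α) {b c t : ℝ} (hb : 0 < b)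
    (hc : 0 < c) (ht : 0 < t) :
    IntervalIntegrable (fun s ↦ fracKernel c (t - s) * relaxation α b s) volume 0 t := by
  obtain ⟨C, hC, h⟩ := abs_relaxation_le hα hb ht
  have h1 := (intervalIntegrable_fracKernel_mul hb hc ht).const_mul C
  rw [intervalIntegrable_iff_integrableOn_Ioo_of_le ht.le] at h1 ⊢
  refine Integrable.mono' h1 ?_ ?_
  · refine ContinuousOn.aestronglyMeasurable ?_ measurableSet_Ioo
    refine ((continuousOn_fracKernel c).comp (by fun_prop) fun s hs ↦ ?_).mul
      ((continuousOn_relaxation hα hb).mono fun s hs ↦ hs.1)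
    exact sub_pos.2 hs.2
  · filter_upwards [ae_restrict_mem measurableSet_Ioo] with s hs
    have h2 := fracKernel_nonneg hc (sub_nonneg.2 hs.2.le)
    rw [norm_mul, Real.norm_of_nonneg h2, Real.norm_eq_abs]
    calc _ ≤ fracKernel c (t - s) * (C * fracKernel b s) := by gcongr; exact h s hs.1 hs.2.le
      _ = _ := by ring

/-- Termwise use of k_c * k_a = k_{a+c}. The same identity computes the L¹ norms of the terms, whose
summability justifies the interchange. -/
lemma integral_fracKernel_mul_relaxation (hα : 0 < α) {b c t : ℝ} (hb : 0 < b)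
    (hc : 0 < c) (ht : 0 < t) :
    ∫ s in (0 : ℝ)..t, fracKernel c (t - s) * relaxation α b s = relaxation α (b + c) t := by
  have hF : ∀ j : ℕ, IntervalIntegrable (fun s ↦ (-1) ^ j * (fracKernel c (t - s) *
      fracKernel (α * j + b) s)) volume 0 t := fun j ↦
    (intervalIntegrable_fracKernel_mul (by positivity) hc ht).const_mul _
  have hn : ∀ j : ℕ, ∫ s in Ioc 0 t, ‖(-1) ^ j * (fracKernel c (t - s) *
      fracKernel (α * j + b) s)‖ = fracKernel (α * j + (b + c)) t := by
    intro j
    rw [← add_assoc, ← integral_fracKernel_mul (by positivity) hc ht,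
      intervalIntegral.integral_of_le ht.le]
    refine setIntegral_congr_fun measurableSet_Ioc fun s hs ↦ ?_
    simp only [norm_mul, norm_pow, norm_neg, norm_one, one_pow, one_mul]
    rw [Real.norm_of_nonneg (fracKernel_nonneg hc (sub_nonneg.2 hs.2)),
      Real.norm_of_nonneg (fracKernel_nonneg (by positivity) hs.1.le)]
  have h := hasSum_integral_of_summable_integral_norm (μ := volume.restrict (Ioc 0 t))
    (F := fun (j : ℕ) s ↦ (-1) ^ j * (fracKernel c (t - s) * fracKernel (α * j + b) s))
    (fun j ↦ (intervalIntegrable_iff_integrableOn_Ioc_of_le ht.le).1 (hF j))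
    ((summable_fracKernel hα (by linarith : 0 < b + c) ht).congr fun j ↦ (hn j).symm)
  rw [intervalIntegral.integral_of_le ht.le]
  refine Eq.trans ?_ (h.tsum_eq.symm.trans (tsum_congr fun j ↦ ?_))
  · refine setIntegral_congr_fun measurableSet_Ioc fun s _ ↦ ?_
    simp only [relaxation]
    rw [← tsum_mul_left]
    exact tsum_congr fun j ↦ by ring
  · rw [integral_const_mul, ← intervalIntegral.integral_of_le ht.le,
      integral_fracKernel_mul (by positivity) hc ht, add_assoc]

end MittagLeffler

/-! ### Positivity, monotonicity and decay of E_α on the negative half-line -/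

section MittagLefflerBounds

variable {α : ℝ}

/-- In h_b = k_b - h_{b+α} the second term is O(t^α) k_b(t), so the first dominates near 0. -/
lemma relaxation_pos_near_zero (hα : 0 < α) {b : ℝ} (hb : 0 < b) :
    ∃ ε, 0 < ε ∧ ∀ t, 0 < t → t < ε → 0 < relaxation α b t := by
  obtain ⟨C, hC, h⟩ := abs_relaxation_le hα (by linarith : 0 < b + α) one_pos
  have hG := Real.Gamma_pos_of_pos hb
  have hG' := Real.Gamma_pos_of_pos (by linarith : 0 < b + α)
  have hlim : Tendsto (fun t : ℝ ↦ C * Real.Gamma b / Real.Gamma (b + α) * t ^ α) (𝓝 0)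
      (𝓝 (C * Real.Gamma b / Real.Gamma (b + α) * 0 ^ α)) :=
    ((Real.continuousAt_rpow_const 0 α (.inr hα.le)).tendsto).const_mul _
  rw [Real.zero_rpow hα.ne', mul_zero] at hlim
  obtain ⟨δ, hδ, hδ'⟩ := Metric.eventually_nhds_iff.1 (hlim.eventually_lt_const one_pos)
  refine ⟨min δ 1, lt_min hδ one_pos, fun t ht htε ↦ ?_⟩
  have h1 := hδ' (y := t) (by
    rw [dist_zero_right, Real.norm_of_nonneg ht.le]; exact htε.trans_le (min_le_left _ _))
  have h2 := (abs_le.1 (h t ht (htε.le.trans (min_le_right _ _)))).2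
  rw [relaxation_eq_sub hα hb ht]
  have h3 : C * fracKernel (b + α) t =
      (C * Real.Gamma b / Real.Gamma (b + α) * t ^ α) * fracKernel b t := by
    rw [fracKernel, fracKernel, show b + α - 1 = (b - 1) + α by ring, Real.rpow_add ht]
    field_simp
  have h4 := fracKernel_pos hb ht
  nlinarith

/-- Since (t₀-s)/(t-s) ≥ t₀/t ≥ 1 and α-1 ≤ b-1 ≤ 0, the kernel k_α(· - s) decreases from t to t₀ at
least by the factor by which k_b does. This comparison is where α ≤ b ≤ 1 enters the positivity
proof. -/
lemma fracKernel_sub_mul_le (hα : 0 < α) {b s t t₀ : ℝ} (hαb : α ≤ b) (hb : b ≤ 1) (hs : 0 < s)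
    (hst : s < t) (ht : t < t₀) :
    fracKernel α (t₀ - s) ≤ (t₀ / t) ^ (b - 1) * fracKernel α (t - s) := by
  have hG := Real.Gamma_pos_of_pos hα
  have ht0 : 0 < t := hs.trans hst
  have hts : 0 < t - s := sub_pos.2 hst
  rw [fracKernel, fracKernel, ← mul_div_assoc]
  gcongr
  have h1 : t₀ / t ≤ (t₀ - s) / (t - s) := by
    rw [div_le_div_iff₀ ht0 hts]
    nlinarith
  have h2 : 1 ≤ t₀ / t := by rw [le_div_iff₀ ht0]; linarith
  have h3 : ((t₀ - s) / (t - s)) ^ (α - 1) ≤ (t₀ / t) ^ (b - 1) :=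
    (Real.rpow_le_rpow_of_nonpos (by linarith) h1 (by linarith)).trans
      (Real.rpow_le_rpow_of_exponent_le h2 (by linarith))
  rw [Real.div_rpow (by linarith) hts.le, div_le_iff₀ (Real.rpow_pos_of_pos hts _)] at h3
  exact h3

lemma integral_fracKernel_sub (hα : 0 < α) (t₁ t₂ : ℝ) :
    ∫ s in t₁..t₂, fracKernel α (t₂ - s) = fracKernel (α + 1) (t₂ - t₁) := by
  rw [intervalIntegral.integral_comp_sub_left (fun s ↦ fracKernel α s), sub_self]
  simp only [fracKernel]
  rw [intervalIntegral.integral_div, integral_rpow (.inl (by linarith)), sub_add_cancel,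
    Real.zero_rpow hα.ne', sub_zero, add_sub_cancel_right, Real.Gamma_add_one hα.ne']
  have := (Real.Gamma_pos_of_pos hα).ne'
  field_simp

lemma intervalIntegrable_fracKernel_sub (hα : 0 < α) (t₁ t₂ t₃ : ℝ) :
    IntervalIntegrable (fun s ↦ fracKernel α (t₃ - s)) volume t₁ t₂ := by
  have := ((intervalIntegral.intervalIntegrable_rpow' (by linarith : -1 < α - 1)
    (a := t₃ - t₁) (b := t₃ - t₂)).div_const (Real.Gamma α)).comp_sub_left t₃
  simpa [fracKernel] using this

/-- Positivity of the solution of `h = k_b - k_α * h` for `α ≤ b ≤ 1`. -/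
theorem relaxation_pos (hα : 0 < α) {b : ℝ} (hαb : α ≤ b) (hb : b ≤ 1) {t : ℝ} (ht : 0 < t) :
    0 < relaxation α b t := by
  have hb0 : 0 < b := hα.trans_le hαb
  -- Let t₀ be the first zero and u < t₀ a maximum point of h = h_b near t₀, and put ρ =
  -- (t₀/u)^{b-1}. In the equation at t₀ the history up to u costs at most ρ (k_b(u) - h(u)), while
  -- k_b(t₀) = ρ k_b(u). The history after u costs less than h(u)/2. Hence h(t₀) > (ρ - 1/2) h(u) ≥
  -- 0, a contradiction.
  by_contra hneg
  obtain ⟨ε, hε, hpos⟩ := relaxation_pos_near_zero hα hb0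
  have hcont := continuousOn_relaxation hα hb0
  set S : Set ℝ := Ici ε ∩ relaxation α b ⁻¹' Iic 0 with hS
  have hSc : IsClosed S :=
    (hcont.mono fun x (hx : ε ≤ x) ↦ hε.trans_le hx).preimage_isClosed_of_isClosed isClosed_Ici
      isClosed_Iic
  have htS : t ∈ S := by
    refine ⟨?_, not_lt.1 hneg⟩
    by_contra h
    exact hneg (hpos t ht (not_le.1 h))
  have hSb : BddBelow S := ⟨ε, fun x hx ↦ hx.1⟩
  set t₀ := sInf S
  have ht₀ : t₀ ∈ S := hSc.csInf_mem ⟨t, htS⟩ hSb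
  have ht₀0 : 0 < t₀ := hε.trans_le ht₀.1
  have hlt : ∀ s, 0 < s → s < t₀ → 0 < relaxation α b s := by
    intro s hs hst
    by_contra h
    refine (notMem_of_lt_csInf hst hSb) ⟨?_, not_lt.1 h⟩
    by_contra h'
    exact h (hpos s hs (not_le.1 h'))
  have hlim : Tendsto (fun x : ℝ ↦ fracKernel (α + 1) (t₀ - x)) (𝓝 t₀) (𝓝 0) := by
    have h1 : ContinuousAt (fun x : ℝ ↦ fracKernel (α + 1) (t₀ - x)) t₀ := by
      simp only [fracKernel, add_sub_cancel_right]
      refine ContinuousAt.div_const ?_ _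
      exact ContinuousAt.rpow_const (by fun_prop) (.inr hα.le)
    have h2 := h1.tendsto
    simpa [fracKernel, Real.zero_rpow hα.ne'] using h2
  obtain ⟨δ, hδ, hδ'⟩ := Metric.eventually_nhds_iff.1
    (hlim.eventually_lt_const (by norm_num : (0 : ℝ) < 1 / 2))
  -- The first bound keeps t₀/u ≤ 2, hence ρ ≥ 1/2; the second keeps the kernel mass on [u, t₀]
  -- below 1/2.
  set t₁ := max (t₀ / 2) (t₀ - δ / 2)
  have h1a : t₀ / 2 ≤ t₁ := le_max_left _ _
  have h1b : t₀ - δ / 2 ≤ t₁ := le_max_right _ _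
  have h1c : t₁ < t₀ := max_lt (by linarith) (by linarith)
  have hsub : Icc t₁ t₀ ⊆ Ioi 0 := fun x hx ↦ by
    have := hx.1
    simp only [mem_Ioi]
    linarith
  obtain ⟨u, hu, hmax⟩ := isCompact_Icc.exists_isMaxOn (nonempty_Icc.2 h1c.le) (hcont.mono hsub)
  have hu0 : 0 < u := hsub hu
  have hhu : 0 < relaxation α b u :=
    (hlt t₁ (by linarith) h1c).trans_le (hmax (left_mem_Icc.2 h1c.le))
  have hut : u < t₀ := lt_of_le_of_ne hu.2 fun h ↦ by
    rw [h] at hhu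
    exact absurd hhu (not_lt.2 ht₀.2)
  have hI := intervalIntegrable_fracKernel_mul_relaxation hα hb0 hα ht₀0
  have hI1 := hI.mono_set (c := 0) (d := u)
    (by rw [uIcc_of_le hu0.le, uIcc_of_le ht₀0.le]; exact Icc_subset_Icc_right hut.le)
  have hI2 := hI.mono_set (c := u) (d := t₀)
    (by rw [uIcc_of_le hut.le, uIcc_of_le ht₀0.le]; exact Icc_subset_Icc_left hu0.le)
  have e0 := integral_fracKernel_mul_relaxation hα hb0 hα ht₀0
  have e1 := integral_fracKernel_mul_relaxation hα hb0 hα hu0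
  have e2 := relaxation_eq_sub hα hb0 ht₀0
  have e3 := relaxation_eq_sub hα hb0 hu0
  rw [← intervalIntegral.integral_add_adjacent_intervals hI1 hI2] at e0
  have b1 : ∫ s in (0 : ℝ)..u, fracKernel α (t₀ - s) * relaxation α b s ≤
      (t₀ / u) ^ (b - 1) * relaxation α (b + α) u := by
    rw [← e1, ← intervalIntegral.integral_const_mul]
    refine intervalIntegral.integral_mono_on_of_le_Ioo hu0.le hI1
      ((intervalIntegrable_fracKernel_mul_relaxation hα hb0 hα hu0).const_mul _) fun s hs ↦ ?_
    rw [← mul_assoc]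
    exact mul_le_mul_of_nonneg_right (fracKernel_sub_mul_le hα hαb hb hs.1 hs.2 hut)
      (hlt s hs.1 (hs.2.trans hut)).le
  have b2 : ∫ s in u..t₀, fracKernel α (t₀ - s) * relaxation α b s ≤
      fracKernel (α + 1) (t₀ - u) * relaxation α b u := by
    rw [← integral_fracKernel_sub hα, ← intervalIntegral.integral_mul_const]
    refine intervalIntegral.integral_mono_on_of_le_Ioo hut.le hI2
      ((intervalIntegrable_fracKernel_sub hα _ _ _).mul_const _) fun s hs ↦ ?_
    exact mul_le_mul_of_nonneg_left (hmax ⟨hu.1.trans hs.1.le, hs.2.le⟩)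
      (fracKernel_nonneg hα (by linarith [hs.2]))
  have b3 : fracKernel (α + 1) (t₀ - u) < 1 / 2 := by
    refine hδ' ?_
    rw [Real.dist_eq, abs_lt]
    constructor <;> linarith [hu.1]
  have b4 : fracKernel b t₀ = (t₀ / u) ^ (b - 1) * fracKernel b u := by
    rw [fracKernel, fracKernel, Real.div_rpow ht₀0.le hu0.le]
    have := (Real.rpow_pos_of_pos hu0 (b - 1)).ne'
    field_simp
  have b5 : 1 / 2 ≤ (t₀ / u) ^ (b - 1) := by
    have h1 : 1 ≤ t₀ / u := by rw [le_div_iff₀ hu0]; linarith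
    have h2 : t₀ / u ≤ 2 := by rw [div_le_iff₀ hu0]; linarith [hu.1]
    calc (1 / 2 : ℝ) = 2 ^ (-1 : ℝ) := by rw [Real.rpow_neg_one]; norm_num
      _ ≤ (t₀ / u) ^ (-1 : ℝ) := Real.rpow_le_rpow_of_nonpos (by linarith) h2 (by norm_num)
      _ ≤ _ := Real.rpow_le_rpow_of_exponent_le h1 (by linarith)
  have h₀ : relaxation α b t₀ ≤ 0 := ht₀.2
  have f1 : relaxation α (b + α) u = fracKernel b u - relaxation α b u := by linarith
  rw [f1] at b1
  nlinarith

/-- As k_1 = 1, the integral of h_α is k_1 * h_α = h_{1+α} = 1 - h_1. Positivity of h_α thereby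
becomes monotonicity of h_1. -/
lemma relaxation_one_eq (hα : 0 < α) {t : ℝ} (ht : 0 < t) :
    relaxation α 1 t = 1 - ∫ s in (0 : ℝ)..t, relaxation α α s := by
  have h := integral_fracKernel_mul_relaxation hα hα one_pos ht
  simp only [fracKernel_one, one_mul] at h
  rw [h, relaxation_eq_sub hα one_pos ht, fracKernel_one, add_comm]

lemma intervalIntegrable_relaxation (hα : 0 < α) {t : ℝ} (ht : 0 < t) :
    IntervalIntegrable (relaxation α α) volume 0 t := by
  have h := intervalIntegrable_fracKernel_mul_relaxation hα hα one_pos ht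
  simpa only [fracKernel_one, one_mul] using h

lemma relaxation_one_antitone (hα : 0 < α) (hα1 : α ≤ 1) {s t : ℝ} (hs : 0 < s) (hst : s ≤ t) :
    relaxation α 1 t ≤ relaxation α 1 s := by
  have ht := hs.trans_le hst
  rw [relaxation_one_eq hα hs, relaxation_one_eq hα ht, ← sub_nonneg]
  have h := intervalIntegral.integral_interval_sub_left (intervalIntegrable_relaxation hα ht)
    (intervalIntegrable_relaxation hα hs)
  have h2 : 0 ≤ ∫ x in s..t, relaxation α α x :=
    intervalIntegral.integral_nonneg hst fun x hx ↦
      (relaxation_pos hα le_rfl hα1 (hs.trans_le hx.1)).le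
  linarith

lemma relaxation_one_le_one (hα : 0 < α) (hα1 : α ≤ 1) {t : ℝ} (ht : 0 < t) :
    relaxation α 1 t ≤ 1 := by
  rw [relaxation_one_eq hα ht, sub_le_self_iff, intervalIntegral.integral_of_le ht.le]
  exact setIntegral_nonneg measurableSet_Ioc fun x hx ↦ (relaxation_pos hα le_rfl hα1 hx.1).le

/-- Because h_1 decreases, k_α * h_1 at t is at least h_1(t) t^α / Γ(1+α). It also equals 1 - h_1(t)
< 1. -/
lemma relaxation_one_mul_le (hα : 0 < α) (hα1 : α ≤ 1) {t : ℝ} (ht : 0 < t) :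
    relaxation α 1 t * t ^ α ≤ Real.Gamma (1 + α) := by
  have h1 : fracKernel (α + 1) (t - 0) * relaxation α 1 t ≤ relaxation α (1 + α) t := by
    rw [← integral_fracKernel_mul_relaxation hα one_pos hα ht, ← integral_fracKernel_sub hα,
      ← intervalIntegral.integral_mul_const]
    refine intervalIntegral.integral_mono_on_of_le_Ioo ht.le
      ((intervalIntegrable_fracKernel_sub hα _ _ _).mul_const _)
      (intervalIntegrable_fracKernel_mul_relaxation hα one_pos hα ht) fun s hs ↦ ?_
    exact mul_le_mul_of_nonneg_left (relaxation_one_antitone hα hα1 hs.1 hs.2.le)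
      (fracKernel_nonneg hα (by linarith [hs.2]))
  have h2 := relaxation_eq_sub hα one_pos ht
  have h3 := relaxation_pos hα hα1 le_rfl ht
  rw [fracKernel_one] at h2
  rw [sub_zero, fracKernel, add_sub_cancel_right, add_comm α 1, div_mul_eq_mul_div] at h1
  have h4 : t ^ α * relaxation α 1 t / Real.Gamma (1 + α) ≤ 1 := by linarith
  rw [div_le_one (Real.Gamma_pos_of_pos (by linarith))] at h4
  linarith

lemma mittagLeffler_neg_eq (hα : 0 < α) {x : ℝ} (hx : 0 < x) :
    mittagLeffler α (-x) = relaxation α 1 (x ^ (1 / α)) := by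
  refine tsum_congr fun j ↦ ?_
  rw [fracKernel, add_sub_cancel_right, ← Real.rpow_mul hx.le, ← mul_assoc,
    one_div_mul_cancel hα.ne', one_mul, Real.rpow_natCast, neg_pow]
  ring

lemma mittagLeffler_zero : mittagLeffler α 0 = 1 := by
  rw [mittagLeffler, tsum_eq_single 0 fun j hj ↦ by simp [hj]]
  simp

lemma mittagLeffler_neg_nonneg (hα : 0 < α) (hα1 : α ≤ 1) {x : ℝ} (hx : 0 ≤ x) :
    0 ≤ mittagLeffler α (-x) := by
  rcases hx.eq_or_lt with rfl | hx
  · simp [mittagLeffler_zero]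
  · rw [mittagLeffler_neg_eq hα hx]
    exact (relaxation_pos hα hα1 le_rfl (Real.rpow_pos_of_pos hx _)).le

lemma mittagLeffler_neg_le_one (hα : 0 < α) (hα1 : α ≤ 1) {x : ℝ} (hx : 0 ≤ x) :
    mittagLeffler α (-x) ≤ 1 := by
  rcases hx.eq_or_lt with rfl | hx
  · simp [mittagLeffler_zero]
  · rw [mittagLeffler_neg_eq hα hx]
    exact relaxation_one_le_one hα hα1 (Real.rpow_pos_of_pos hx _)

lemma mittagLeffler_neg_le_div (hα : 0 < α) (hα1 : α ≤ 1) {x : ℝ} (hx : 0 < x) :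
    mittagLeffler α (-x) ≤ Real.Gamma (1 + α) / x := by
  have h := relaxation_one_mul_le hα hα1 (Real.rpow_pos_of_pos hx (1 / α))
  rw [← mittagLeffler_neg_eq hα hx, ← Real.rpow_mul hx.le, one_div_mul_cancel hα.ne',
    Real.rpow_one] at h
  rwa [le_div_iff₀ hx]

lemma continuous_mittagLeffler (hα : 0 < α) : Continuous (mittagLeffler α) := by
  refine continuous_iff_continuousAt.2 fun x ↦ ?_
  set R := |x| + 1
  have hR : 0 < R := by positivity
  refine ContinuousOn.continuousAt (s := Ioo (-R) R) ?_ (Ioo_mem_nhds ?_ ?_)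
  · have hs := summable_fracKernel hα one_pos (Real.rpow_pos_of_pos hR (1 / α))
    refine continuousOn_tsum (fun j ↦ by fun_prop) hs fun j y hy ↦ ?_
    rw [fracKernel, add_sub_cancel_right, ← Real.rpow_mul hR.le, ← mul_assoc,
      one_div_mul_cancel hα.ne', one_mul, Real.rpow_natCast, norm_div, norm_pow, Real.norm_eq_abs,
      Real.norm_of_nonneg (Real.Gamma_pos_of_pos (by positivity)).le]
    have := Real.Gamma_pos_of_pos (by positivity : 0 < α * (j : ℝ) + 1)
    gcongr
    exact (abs_lt.2 hy).le
  · have := neg_abs_le x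
    simp only [R]
    linarith
  · have := le_abs_self x
    simp only [R]
    linarith

end MittagLefflerBounds

/-! ### Wiener integrals: isometry and existence -/

section WienerIntegral

namespace StepFunction

variable {a b : ℝ}

lemma mem_Icc (S : StepFunction a b) (i : Fin (S.n + 1)) : S.p i ∈ Icc a b :=
  ⟨S.first.symm.le.trans (S.monotone (Fin.zero_le i)),
    (S.monotone (Fin.le_last i)).trans S.last.le⟩

lemma exists_mem_Ioc (S : StepFunction a b) {u : ℝ} (hu : u ∈ Ioc a b) :
    ∃ i : Fin S.n, u ∈ Ioc (S.p i.castSucc) (S.p i.succ) := by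
  by_contra! h
  have h1 : ∀ i : Fin (S.n + 1), S.p i < u := by
    intro i
    induction i using Fin.induction with
    | zero => rw [S.first]; exact hu.1
    | succ i ih => exact not_le.1 fun hle ↦ h i ⟨ih, hle⟩
  exact absurd (h1 (Fin.last _)) (by rw [S.last]; exact not_lt.2 hu.2)

lemma eval_eq_of_mem (S : StepFunction a b) {u : ℝ} {i : Fin S.n}
    (hu : u ∈ Ioc (S.p i.castSucc) (S.p i.succ)) : S.eval u = S.c i := by
  rw [eval, Finset.sum_eq_single i, indicator_of_mem hu]
  · intro j _ hji
    refine indicator_of_notMem (fun hj ↦ ?_) _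
    rcases lt_or_gt_of_ne hji with h | h
    · have : S.p j.succ ≤ S.p i.castSucc := S.monotone (Fin.succ_le_castSucc_iff.2 h)
      exact absurd (hj.2.trans this) (not_le.2 hu.1)
    · have : S.p i.succ ≤ S.p j.castSucc := S.monotone (Fin.succ_le_castSucc_iff.2 h)
      exact absurd (hu.2.trans this) (not_le.2 hj.1)
  · simp

/-- A step function as an element of `L₂((a, b])`. -/
noncomputable def evalLp (S : StepFunction a b) : Lp ℝ 2 (volume.restrict (Ioc a b)) :=
  ∑ i : Fin S.n, S.c i • indicatorConstLp 2 (measurableSet_Ioc (a := S.p i.castSucc)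
    (b := S.p i.succ)) (measure_ne_top (volume.restrict (Ioc a b)) _) (1 : ℝ)

lemma coeFn_evalLp (S : StepFunction a b) :
    S.evalLp =ᵐ[volume.restrict (Ioc a b)] S.eval := by
  have h : ∀ᵐ u ∂(volume.restrict (Ioc a b)), ∀ i : Fin S.n,
      (S.c i • indicatorConstLp 2 (measurableSet_Ioc (a := S.p i.castSucc)
    (b := S.p i.succ)) (measure_ne_top (volume.restrict (Ioc a b)) _) (1 : ℝ) : Lp ℝ 2 _) u =
      (Ioc (S.p i.castSucc) (S.p i.succ)).indicator (fun _ ↦ S.c i) u := by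
    rw [ae_all_iff]
    intro i
    filter_upwards [Lp.coeFn_smul (S.c i) (indicatorConstLp 2 (measurableSet_Ioc
      (a := S.p i.castSucc) (b := S.p i.succ)) (measure_ne_top (volume.restrict (Ioc a b)) _)
      (1 : ℝ)), indicatorConstLp_coeFn (p := 2) (hs := measurableSet_Ioc
      (a := S.p i.castSucc) (b := S.p i.succ))
      (hμs := measure_ne_top (volume.restrict (Ioc a b)) _) (c := (1 : ℝ))] with u h1 h2
    rw [h1, Pi.smul_apply, h2]
    simp [indicator]
  filter_upwards [h, Lp.coeFn_finsetSum Finset.univ fun i : Fin S.n ↦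
    (S.c i • indicatorConstLp 2 (measurableSet_Ioc (a := S.p i.castSucc)
    (b := S.p i.succ)) (measure_ne_top (volume.restrict (Ioc a b)) _) (1 : ℝ) : Lp ℝ 2 _)]
    with u h1 h2
  rw [evalLp, h2, eval, Finset.sum_apply]
  exact Finset.sum_congr rfl fun i _ ↦ h1 i

end StepFunction

/-- The overlap length is written with minima so that it matches, term by term, the covariance of
two Brownian increments. -/
lemma inner_indicator_Ioc {a b p q p' q' : ℝ} (hp : a ≤ p) (hpq : p ≤ q) (hq : q ≤ b)
    (hpq' : p' ≤ q') :
    ⟪(indicatorConstLp 2 (measurableSet_Ioc (a := p) (b := q))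
        (measure_ne_top (volume.restrict (Ioc a b)) _) (1 : ℝ)),
      (indicatorConstLp 2 (measurableSet_Ioc (a := p') (b := q'))
        (measure_ne_top (volume.restrict (Ioc a b)) _) (1 : ℝ))⟫_ℝ =
    min q q' - min q p' - min p q' + min p p' := by
  have h : Ioc p q ∩ Ioc p' q' ⊆ Ioc a b := fun u hu ↦ ⟨hp.trans_lt hu.1.1, hu.1.2.trans hq⟩
  rw [L2.real_inner_indicatorConstLp_one_indicatorConstLp_one, Measure.real,
    Measure.restrict_apply (measurableSet_Ioc.inter measurableSet_Ioc),
    inter_eq_left.2 h, Ioc_inter_Ioc,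
    Real.volume_Ioc, ENNReal.toReal_ofReal']
  simp only [min_def, max_def]
  split_ifs <;> linarith

variable {Ω : Type*} [MeasurableSpace Ω] {P : Measure Ω}

/-- The process `X` has the covariance `E⟨X(s), X(t)⟩ = v min(s, t)` of a Brownian motion. -/
structure HasBrownianCovariance (P : Measure Ω) (X : ℝ → Ω → ℂ) (v : ℝ) : Prop where
  memLp : ∀ s, 0 ≤ s → MemLp (X s) 2 P
  cov : ∀ s t, 0 ≤ s → s ≤ t → ∫ ω, ⟪X s ω, X t ω⟫_ℝ ∂P = v * s

namespace HasBrownianCovariance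

variable {X : ℝ → Ω → ℂ} {v : ℝ}

open Classical in
/-- The value at time `s` as an element of `L₂(Ω)`. -/
noncomputable def valueLp (_ : HasBrownianCovariance P X v) (s : ℝ) : Lp ℂ 2 P :=
  if h : MemLp (X s) 2 P then h.toLp else 0

lemma coeFn_valueLp (hX : HasBrownianCovariance P X v) {s : ℝ} (hs : 0 ≤ s) :
    hX.valueLp s =ᵐ[P] X s := by
  rw [valueLp, dif_pos (hX.memLp s hs)]
  exact MemLp.coeFn_toLp _

lemma inner_valueLp (hX : HasBrownianCovariance P X v) {s t : ℝ} (hs : 0 ≤ s) (ht : 0 ≤ t) :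
    ⟪hX.valueLp s, hX.valueLp t⟫_ℝ = v * min s t := by
  have key : ∀ s t, 0 ≤ s → s ≤ t → ⟪hX.valueLp s, hX.valueLp t⟫_ℝ = v * s := by
    intro s t hs hst
    rw [L2.inner_def, ← hX.cov s t hs hst]
    refine integral_congr_ae ?_
    filter_upwards [hX.coeFn_valueLp hs, hX.coeFn_valueLp (hs.trans hst)] with ω h1 h2
    rw [h1, h2]
  rcases le_total s t with h | h
  · rw [key s t hs h, min_eq_left h]
  · rw [real_inner_comm, key t s ht h, min_eq_right h]

/-- The integral of a step function as an element of `L₂(Ω)`. -/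
noncomputable def stepLp {r : ℝ} (hX : HasBrownianCovariance P X v) (S : StepFunction 0 r) :
    Lp ℂ 2 P :=
  ∑ i : Fin S.n, S.c i • (hX.valueLp (S.p i.succ) - hX.valueLp (S.p i.castSucc))

variable {r : ℝ}

lemma coeFn_stepLp (hX : HasBrownianCovariance P X v) (S : StepFunction 0 r) :
    hX.stepLp S =ᵐ[P] S.integral X := by
  have h : ∀ᵐ ω ∂P, ∀ i : Fin S.n,
      (S.c i • (hX.valueLp (S.p i.succ) - hX.valueLp (S.p i.castSucc)) : Lp ℂ 2 P) ω =
      (S.c i : ℂ) * (X (S.p i.succ) ω - X (S.p i.castSucc) ω) := by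
    rw [ae_all_iff]
    intro i
    filter_upwards [Lp.coeFn_smul (S.c i) (hX.valueLp (S.p i.succ) - hX.valueLp (S.p i.castSucc)),
      Lp.coeFn_sub (hX.valueLp (S.p i.succ)) (hX.valueLp (S.p i.castSucc)),
      hX.coeFn_valueLp (S.mem_Icc i.succ).1, hX.coeFn_valueLp (S.mem_Icc i.castSucc).1]
      with ω h1 h2 h3 h4
    rw [h1, Pi.smul_apply, h2, Pi.sub_apply, h3, h4, Complex.real_smul]
  filter_upwards [h, Lp.coeFn_finsetSum Finset.univ fun i : Fin S.n ↦
    (S.c i • (hX.valueLp (S.p i.succ) - hX.valueLp (S.p i.castSucc)) : Lp ℂ 2 P)] with ω h1 h2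
  rw [stepLp, h2, StepFunction.integral, Finset.sum_apply]
  exact Finset.sum_congr rfl fun i _ ↦ h1 i

/-- The isometry in polarized form, so that two step functions on different partitions can be
compared without a common refinement. -/
lemma inner_stepLp (hX : HasBrownianCovariance P X v) (S S' : StepFunction 0 r) :
    ⟪hX.stepLp S, hX.stepLp S'⟫_ℝ = v * ⟪S.evalLp, S'.evalLp⟫_ℝ := by
  simp only [stepLp, StepFunction.evalLp, sum_inner, inner_sum, Finset.mul_sum]
  refine Finset.sum_congr rfl fun j _ ↦ Finset.sum_congr rfl fun i _ ↦ ?_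
  have m1 := (S.mem_Icc i.succ).1
  have m2 := (S.mem_Icc i.castSucc).1
  have m3 := (S'.mem_Icc j.succ).1
  have m4 := (S'.mem_Icc j.castSucc).1
  rw [real_inner_smul_left, real_inner_smul_right, real_inner_smul_left, real_inner_smul_right,
    inner_indicator_Ioc m2 (S.monotone (Fin.castSucc_lt_succ).le) (S.mem_Icc i.succ).2
      (S'.monotone (Fin.castSucc_lt_succ).le), inner_sub_left, inner_sub_right, inner_sub_right,
    hX.inner_valueLp m1 m3, hX.inner_valueLp m1 m4, hX.inner_valueLp m2 m3,
    hX.inner_valueLp m2 m4]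
  ring

lemma norm_stepLp_sq (hX : HasBrownianCovariance P X v) (S : StepFunction 0 r) :
    ‖hX.stepLp S‖ ^ 2 = v * ‖S.evalLp‖ ^ 2 := by
  rw [← real_inner_self_eq_norm_sq, ← real_inner_self_eq_norm_sq, hX.inner_stepLp]

lemma norm_stepLp_sub_sq (hX : HasBrownianCovariance P X v) (S S' : StepFunction 0 r) :
    ‖hX.stepLp S - hX.stepLp S'‖ ^ 2 = v * ‖S.evalLp - S'.evalLp‖ ^ 2 := by
  rw [@norm_sub_sq_real, @norm_sub_sq_real, hX.norm_stepLp_sq, hX.norm_stepLp_sq, hX.inner_stepLp]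
  ring

lemma norm_stepLp_sub (hX : HasBrownianCovariance P X v) (hv : 0 ≤ v) (S S' : StepFunction 0 r) :
    ‖hX.stepLp S - hX.stepLp S'‖ = √v * ‖S.evalLp - S'.evalLp‖ := by
  rw [← Real.sqrt_sq (norm_nonneg (hX.stepLp S - hX.stepLp S')), hX.norm_stepLp_sub_sq,
    Real.sqrt_mul hv, Real.sqrt_sq (norm_nonneg _)]

end HasBrownianCovariance

lemma tendsto_evalLp_iff {r : ℝ} {g : ℝ → ℝ} (hg : MemLp g 2 (volume.restrict (Ioc 0 r)))
    (S : ℕ → StepFunction 0 r) :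
    Tendsto (fun n ↦ (S n).evalLp) atTop (𝓝 (hg.toLp g)) ↔
      Tendsto (fun n ↦ eLpNorm (fun u ↦ (S n).eval u - g u) 2 (volume.restrict (Ioc 0 r)))
        atTop (𝓝 0) := by
  rw [Lp.tendsto_Lp_iff_tendsto_eLpNorm']
  refine tendsto_congr fun n ↦ eLpNorm_congr_ae ?_
  filter_upwards [(S n).coeFn_evalLp, hg.coeFn_toLp] with u h1 h2
  rw [Pi.sub_apply, h1, h2]

lemma tendsto_stepLp_iff {X : ℝ → Ω → ℂ} {v r : ℝ} (hX : HasBrownianCovariance P X v)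
    (Z : Lp ℂ 2 P) (S : ℕ → StepFunction 0 r) :
    Tendsto (fun n ↦ hX.stepLp (S n)) atTop (𝓝 Z) ↔
      Tendsto (fun n ↦ eLpNorm (fun ω ↦ (S n).integral X ω - Z ω) 2 P) atTop (𝓝 0) := by
  rw [Lp.tendsto_Lp_iff_tendsto_eLpNorm']
  refine tendsto_congr fun n ↦ eLpNorm_congr_ae ?_
  filter_upwards [hX.coeFn_stepLp (S n)] with ω h1
  rw [Pi.sub_apply, h1]

/-- Itô's isometry for the Wiener integral. -/
theorem IsWienerIntegral.norm_sq {X : ℝ → Ω → ℂ} {v r : ℝ} (hX : HasBrownianCovariance P X v)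
    {g : ℝ → ℝ} (hg : MemLp g 2 (volume.restrict (Ioc 0 r))) {Z : Lp ℂ 2 P}
    (hZ : IsWienerIntegral P X 0 r g Z) : ‖Z‖ ^ 2 = v * ∫ u in Ioc 0 r, g u ^ 2 := by
  obtain ⟨S, h1, h2⟩ := hZ
  rw [← tendsto_evalLp_iff hg] at h1
  rw [← tendsto_stepLp_iff hX] at h2
  have h3 := (h2.norm.pow 2)
  simp only [hX.norm_stepLp_sq] at h3
  have h4 := tendsto_nhds_unique h3 ((h1.norm.pow 2).const_mul v)
  rw [h4, ← real_inner_self_eq_norm_sq, L2.inner_def]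
  congr 1
  refine integral_congr_ae ?_
  filter_upwards [hg.coeFn_toLp] with u hu
  rw [hu, real_inner_self_eq_norm_sq, Real.norm_eq_abs, sq_abs]

/-- The step function on a uniform partition interpolating `g` at the right end points. -/
noncomputable def uniformStep {r : ℝ} (hr : 0 ≤ r) (g : ℝ → ℝ) (n : ℕ) : StepFunction 0 r where
  n := n + 1
  p i := r * (i : ℕ) / (n + 1)
  monotone i j hij := by
    have : ((i : ℕ) : ℝ) ≤ (j : ℕ) := by exact_mod_cast hij
    beta_reduce
    gcongr
  first := by simp
  last := by
    have : (n + 1 : ℝ) ≠ 0 := by positivity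
    simp [this]
  c i := g (r * ((i : ℕ) + 1) / (n + 1))

lemma tendsto_uniformStep {r : ℝ} (hr : 0 < r) {g : ℝ → ℝ} (hg : Continuous g) :
    Tendsto (fun n ↦ eLpNorm (fun u ↦ (uniformStep hr.le g n).eval u - g u) 2
      (volume.restrict (Ioc 0 r))) atTop (𝓝 0) := by
  rw [ENNReal.tendsto_nhds_zero]
  intro ε hε
  have hlim : Tendsto (fun δ : ℝ ↦ (volume.restrict (Ioc 0 r)) univ ^ (2 : ℝ≥0∞).toReal⁻¹ *
      ENNReal.ofReal δ) (𝓝[>] 0) (𝓝 0) := by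
    have h1 : Tendsto (fun δ : ℝ ↦ ENNReal.ofReal δ) (𝓝[>] 0) (𝓝 0) := by
      have := (ENNReal.continuous_ofReal.tendsto 0).mono_left (nhdsWithin_le_nhds (s := Ioi 0))
      simpa using this
    have h2 := ENNReal.Tendsto.const_mul (a := (volume.restrict (Ioc 0 r)) univ ^
      (2 : ℝ≥0∞).toReal⁻¹) h1 (.inr (ENNReal.rpow_ne_top_of_nonneg (by simp)
        (measure_ne_top _ _)))
    simpa using h2
  obtain ⟨δ, hδε, hδ⟩ := ((hlim.eventually (ge_mem_nhds hε)).and self_mem_nhdsWithin).exists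
  have hδ0 : (0 : ℝ) < δ := hδ
  have huc := isCompact_Icc.uniformContinuousOn_of_continuous (hg.continuousOn (s := Icc 0 r))
  obtain ⟨η, hη, hη'⟩ := Metric.uniformContinuousOn_iff.1 huc δ hδ0
  have hmesh : Tendsto (fun n : ℕ ↦ r / ((n : ℝ) + 1)) atTop (𝓝 0) :=
    tendsto_const_nhds.div_atTop (tendsto_atTop_add_const_right _ _ tendsto_natCast_atTop_atTop)
  filter_upwards [hmesh.eventually_lt_const hη] with n hn
  refine (eLpNorm_le_of_ae_bound (C := δ) ?_).trans hδε
  filter_upwards [ae_restrict_mem measurableSet_Ioc] with u hu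
  obtain ⟨i, hi⟩ := (uniformStep hr.le g n).exists_mem_Ioc hu
  have hmem := (uniformStep hr.le g n).mem_Icc i.succ
  have e1 : (uniformStep hr.le g n).p i.succ = r * (((i : ℕ) : ℝ) + 1) / (n + 1) := by
    change r * (((i : ℕ) + 1 : ℕ) : ℝ) / (n + 1) = _
    push_cast
    rfl
  have e2 : (uniformStep hr.le g n).p i.castSucc = r * ((i : ℕ) : ℝ) / (n + 1) := rfl
  have e3 : (uniformStep hr.le g n).c i = g (r * (((i : ℕ) : ℝ) + 1) / (n + 1)) := rfl
  rw [StepFunction.eval_eq_of_mem _ hi, e3]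
  rw [e1, e2] at hi
  rw [e1] at hmem
  have h5 : r * (((i : ℕ) : ℝ) + 1) / (n + 1) = r * (i : ℕ) / (n + 1) + r / (n + 1) := by ring
  have h6 := hη' _ hmem _ ⟨hu.1.le, hu.2⟩ (by
    rw [Real.dist_eq, abs_lt]
    constructor <;> linarith [hi.1, hi.2])
  rw [Real.dist_eq] at h6
  exact h6.le

/-- Uniform step functions converge to g in L₂(0, r), so by the isometry their integrals are Cauchy
in L₂(Ω). -/
theorem exists_isWienerIntegral {X : ℝ → Ω → ℂ} {v r : ℝ} (hX : HasBrownianCovariance P X v)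
    (hv : 0 ≤ v) (hr : 0 < r) {g : ℝ → ℝ} (hg : Continuous g)
    (hg2 : MemLp g 2 (volume.restrict (Ioc 0 r))) :
    ∃ Z, IsWienerIntegral P X 0 r g Z := by
  set S := fun n ↦ uniformStep hr.le g n
  have h1 := tendsto_uniformStep hr hg
  have h2 := ((tendsto_evalLp_iff hg2 S).2 h1).cauchySeq
  have h3 : CauchySeq fun n ↦ hX.stepLp (S n) := by
    rw [Metric.cauchySeq_iff'] at h2 ⊢
    intro ε hε
    -- The added 1 covers v = 0.
    obtain ⟨N, hN⟩ := h2 (ε / (√v + 1)) (by positivity)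
    refine ⟨N, fun n hn ↦ ?_⟩
    have h4 := hN n hn
    rw [dist_eq_norm] at h4 ⊢
    rw [hX.norm_stepLp_sub hv]
    rw [lt_div_iff₀ (by positivity)] at h4
    nlinarith [norm_nonneg ((S n).evalLp - (S N).evalLp)]
  obtain ⟨Z, hZ⟩ := cauchySeq_tendsto_of_complete h3
  exact ⟨Z, S, h1, (tendsto_stepLp_iff hX Z S).1 hZ⟩

theorem isWienerIntegral_wienerIntegral {X : ℝ → Ω → ℂ} {a b : ℝ} {g : ℝ → ℝ}
    (h : ∃ Z, IsWienerIntegral P X a b g Z) :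
    IsWienerIntegral P X a b g (wienerIntegral P X a b g) := by
  rw [wienerIntegral, dif_pos h]
  exact h.choose_spec

end WienerIntegral

/-! ### Mean-square size of the kernels -/

section KernelEstimates

variable {α : ℝ}

/-- The squared `L₂(0, r)` norm of the kernel `E_α(-λ_ℓ (r - s)^α)`. -/
noncomputable def kernelEnergy (α : ℝ) (ℓ : ℕ) (r : ℝ) : ℝ :=
  ∫ s in Ioc 0 r, kernelML α ℓ r s ^ 2

lemma eigenvalue_nonneg (ℓ : ℕ) : 0 ≤ eigenvalue ℓ := by
  unfold eigenvalue
  positivity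

lemma kernelEnergy_eq (ℓ : ℕ) {r : ℝ} (hr : 0 < r) :
    kernelEnergy α ℓ r = ∫ u in (0 : ℝ)..r, mittagLeffler α (-(eigenvalue ℓ * u ^ α)) ^ 2 := by
  rw [kernelEnergy, ← intervalIntegral.integral_of_le hr.le]
  have := intervalIntegral.integral_comp_sub_left (a := 0) (b := r)
    (fun u ↦ mittagLeffler α (-(eigenvalue ℓ * u ^ α)) ^ 2) r
  simp only [sub_self, sub_zero] at this
  rw [← this]
  simp only [kernelML, neg_mul]

lemma continuous_kernelML (hα : 0 < α) (ℓ : ℕ) (r : ℝ) : Continuous (kernelML α ℓ r) :=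
  (continuous_mittagLeffler hα).comp
    (continuous_const.mul ((continuous_const.sub continuous_id).rpow_const fun _ ↦ .inr hα.le))

lemma continuous_relaxation_sq (hα : 0 < α) (lam : ℝ) :
    Continuous fun u : ℝ ↦ mittagLeffler α (-(lam * u ^ α)) ^ 2 :=
  ((continuous_mittagLeffler hα).comp
    (continuous_const.mul (continuous_id.rpow_const fun _ ↦ .inr hα.le)).neg).pow 2

lemma integral_relaxation_sq_le (hα : 0 < α) (hα1 : α ≤ 1) {lam : ℝ} (hlam : 0 ≤ lam) {r : ℝ}
    (hr : 0 ≤ r) : ∫ u in (0 : ℝ)..r, mittagLeffler α (-(lam * u ^ α)) ^ 2 ≤ r := by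
  calc ∫ u in (0 : ℝ)..r, mittagLeffler α (-(lam * u ^ α)) ^ 2 ≤ ∫ u in (0 : ℝ)..r, (1 : ℝ) := by
        refine intervalIntegral.integral_mono_on hr
          ((continuous_relaxation_sq hα lam).intervalIntegrable _ _) (by simp) fun u hu ↦ ?_
        have hx : 0 ≤ lam * u ^ α := mul_nonneg hlam (Real.rpow_nonneg hu.1 _)
        exact pow_le_one₀ (mittagLeffler_neg_nonneg hα hα1 hx) (mittagLeffler_neg_le_one hα hα1 hx)
    _ = r := by simp

/-- Uses E_α ≤ 1 on [0, x] and E_α(-y) ≤ Γ(1+α)/y on [x, r]; the two bounds are of the same order at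
x = lam^{-1/α}. -/
lemma integral_relaxation_sq_le_add (hα : 0 < α) (hα1 : α ≤ 1) {lam : ℝ} (hlam : 0 < lam)
    {x r : ℝ} (hx : 0 < x) (hxr : x ≤ r) :
    ∫ u in (0 : ℝ)..r, mittagLeffler α (-(lam * u ^ α)) ^ 2 ≤
      x + Real.Gamma (1 + α) ^ 2 * lam ^ (-2 : ℝ) * ∫ u in x..r, u ^ (-2 * α) := by
  have hc := continuous_relaxation_sq hα lam
  rw [← intervalIntegral.integral_add_adjacent_intervals (hc.intervalIntegrable 0 x)
    (hc.intervalIntegrable x r)]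
  refine add_le_add (integral_relaxation_sq_le hα hα1 hlam.le hx.le) ?_
  rw [← intervalIntegral.integral_const_mul]
  have h0 : (0 : ℝ) ∉ uIcc x r := by
    rw [uIcc_of_le hxr]
    exact fun h ↦ absurd h.1 (not_le.2 hx)
  refine intervalIntegral.integral_mono_on hxr (hc.intervalIntegrable _ _)
    ((intervalIntegral.intervalIntegrable_rpow (.inr h0)).const_mul _) fun u hu ↦ ?_
  have hu0 : 0 < u := hx.trans_le hu.1
  have hua := Real.rpow_pos_of_pos hu0 α
  have hy : 0 < lam * u ^ α := mul_pos hlam hua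
  calc mittagLeffler α (-(lam * u ^ α)) ^ 2 ≤ (Real.Gamma (1 + α) / (lam * u ^ α)) ^ 2 := by
        gcongr
        · exact mittagLeffler_neg_nonneg hα hα1 hy.le
        · exact mittagLeffler_neg_le_div hα hα1 hy
    _ = _ := by
      rw [show -2 * α = -(α * 2) by ring, Real.rpow_neg hu0.le, Real.rpow_mul hu0.le,
        Real.rpow_neg hlam.le, Real.rpow_two, Real.rpow_two]
      field_simp

/-- Here the upper end r dominates and the lower end is dropped. As 1/α > 2, the initial piece
lam^{-1/α} is absorbed into lam^{-2}. -/
lemma integral_relaxation_sq_le_of_lt_half (hα : 0 < α) (hα2 : α < 1 / 2) {lam r : ℝ} (hlam : 1 ≤ lam)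
    (hr : lam ^ (-(1 / α)) < r) :
    ∫ u in (0 : ℝ)..r, mittagLeffler α (-(lam * u ^ α)) ^ 2 ≤
      (1 + constM α * r ^ (1 - 2 * α)) * lam ^ (-2 : ℝ) := by
  have hl : 0 < lam := by linarith
  have hx := Real.rpow_pos_of_pos hl (-(1 / α))
  have h := integral_relaxation_sq_le_add hα (by linarith) hl hx hr.le
  have h0 : (0 : ℝ) ∉ uIcc (lam ^ (-(1 / α))) r := by
    rw [uIcc_of_le hr.le]
    exact fun h ↦ absurd h.1 (not_le.2 hx)
  rw [integral_rpow (.inr ⟨by linarith, h0⟩), show -2 * α + 1 = 1 - 2 * α by ring] at h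
  have h1 : lam ^ (-(1 / α)) ≤ lam ^ (-2 : ℝ) := by
    refine Real.rpow_le_rpow_of_exponent_le hlam (neg_le_neg ?_)
    rw [le_div_iff₀ hα]
    linarith
  have hM : constM α = Real.Gamma (1 + α) ^ 2 / (1 - 2 * α) := by
    rw [constM, if_neg (by linarith), abs_of_neg (by linarith), neg_sub, div_eq_mul_inv]
  have h2 := Real.rpow_nonneg hx.le (1 - 2 * α)
  have h3 : 0 < 1 - 2 * α := by linarith
  have hG : 0 < Real.Gamma (1 + α) := Real.Gamma_pos_of_pos (by linarith)
  have hl2 := Real.rpow_pos_of_pos hl (-2)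
  calc _ ≤ _ := h
    _ ≤ lam ^ (-2 : ℝ) + Real.Gamma (1 + α) ^ 2 * lam ^ (-2 : ℝ) *
          (r ^ (1 - 2 * α) / (1 - 2 * α)) := by
        gcongr
        linarith
    _ = _ := by rw [hM]; ring

/-- Here the lower end dominates, and lam^{-2} (lam^{-1/α})^{1-2α} = lam^{-1/α} has the order of the
initial piece; the bound is therefore uniform in r. -/
lemma integral_relaxation_sq_le_of_half_lt (hα2 : 1 / 2 < α) (hα1 : α ≤ 1) {lam r : ℝ}
    (hlam : 1 ≤ lam) (hr : lam ^ (-(1 / α)) < r) :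
    ∫ u in (0 : ℝ)..r, mittagLeffler α (-(lam * u ^ α)) ^ 2 ≤
      (1 + constM α) * lam ^ (-(1 / α)) := by
  have hα : 0 < α := by linarith
  have hl : 0 < lam := by linarith
  have hx := Real.rpow_pos_of_pos hl (-(1 / α))
  have h := integral_relaxation_sq_le_add hα hα1 hl hx hr.le
  have h0 : (0 : ℝ) ∉ uIcc (lam ^ (-(1 / α))) r := by
    rw [uIcc_of_le hr.le]
    exact fun h ↦ absurd h.1 (not_le.2 hx)
  rw [integral_rpow (.inr ⟨by linarith, h0⟩), show ∀ a b : ℝ, (a - b) / (-2 * α + 1) =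
    (b - a) / (2 * α - 1) by intro a b; rw [show -2 * α + 1 = -(2 * α - 1) by ring, div_neg,
    ← neg_div, neg_sub], show -2 * α + 1 = -(2 * α - 1) by ring] at h
  have hM : constM α = Real.Gamma (1 + α) ^ 2 / (2 * α - 1) := by
    rw [constM, if_neg (by linarith), abs_of_pos (by linarith), div_eq_mul_inv]
  have h2 := Real.rpow_nonneg (hx.trans hr).le (-(2 * α - 1))
  have h3 : 0 < 2 * α - 1 := by linarith
  have hG : 0 < Real.Gamma (1 + α) := Real.Gamma_pos_of_pos (by linarith)
  have hl2 := Real.rpow_pos_of_pos hl (-2)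
  have h4 : lam ^ (-2 : ℝ) * (lam ^ (-(1 / α))) ^ (-(2 * α - 1)) = lam ^ (-(1 / α)) := by
    rw [← Real.rpow_mul hl.le, ← Real.rpow_add hl]
    congr 1
    field_simp
    ring
  calc _ ≤ _ := h
    _ ≤ lam ^ (-(1 / α)) + Real.Gamma (1 + α) ^ 2 * lam ^ (-2 : ℝ) *
          ((lam ^ (-(1 / α))) ^ (-(2 * α - 1)) / (2 * α - 1)) := by
        gcongr
        linarith
    _ = lam ^ (-(1 / α)) + Real.Gamma (1 + α) ^ 2 / (2 * α - 1) *
          (lam ^ (-2 : ℝ) * (lam ^ (-(1 / α))) ^ (-(2 * α - 1))) := by ring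
    _ = _ := by rw [h4, hM]; ring

/-- The integral of 1/u gives log r + 2 log lam. One of the two available powers of 1/lam is spent
on log lam ≤ lam, which produces the 2 in `critK` and leaves lam^{-1}. -/
lemma integral_relaxation_sq_le_half {lam r : ℝ} (hlam : 1 ≤ lam) (hr : lam ^ (-(1 / (1 / 2 : ℝ))) < r) :
    ∫ u in (0 : ℝ)..r, mittagLeffler (1 / 2) (-(lam * u ^ (1 / 2 : ℝ))) ^ 2 ≤
      critK r ^ 2 * lam ^ (-1 : ℝ) := by
  have hl : 0 < lam := by linarith
  have hx := Real.rpow_pos_of_pos hl (-(1 / (1 / 2 : ℝ)))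
  have hr0 : 0 < r := hx.trans hr
  have h := integral_relaxation_sq_le_add (α := 1 / 2) (by norm_num) (by norm_num) hl hx hr.le
  have h0 : ∫ u in (lam ^ (-(1 / (1 / 2 : ℝ))))..r, u ^ (-2 * (1 / 2 : ℝ)) =
      Real.log r + 2 * Real.log lam := by
    rw [show -2 * (1 / 2 : ℝ) = -1 by norm_num]
    simp only [Real.rpow_neg_one]
    rw [integral_inv_of_pos hx hr0, Real.log_div hr0.ne' hx.ne', Real.log_rpow hl]
    ring
  rw [h0, show -(1 / (1 / 2 : ℝ)) = -2 by norm_num, show (1 + 1 / 2 : ℝ) = 3 / 2 by norm_num] at h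
  have hM : constM (1 / 2) = Real.Gamma (3 / 2) ^ 2 := by rw [constM, if_pos rfl]
  have hM0 : 0 ≤ constM (1 / 2) := by rw [hM]; positivity
  rw [← hM] at h
  have h1 : lam ^ (-2 : ℝ) = (lam ^ (-1 : ℝ)) * (lam ^ (-1 : ℝ)) := by
    rw [← Real.rpow_add hl]; norm_num
  have h2 : 0 < lam ^ (-1 : ℝ) := Real.rpow_pos_of_pos hl _
  have h3 : lam ^ (-1 : ℝ) ≤ 1 := Real.rpow_le_one_of_one_le_of_nonpos hlam (by norm_num)
  have h4 : Real.log lam ≤ lam := (Real.log_le_sub_one_of_pos hl).trans (by linarith)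
  have h5 : lam ^ (-1 : ℝ) * lam = 1 := by
    rw [Real.rpow_neg_one, inv_mul_cancel₀ hl.ne']
  have h6 : lam ^ (-1 : ℝ) * (2 * Real.log lam) ≤ 2 := by nlinarith
  have key : ∀ c, 0 ≤ c → Real.log r ≤ c →
      ∫ u in (0 : ℝ)..r, mittagLeffler (1 / 2) (-(lam * u ^ (1 / 2 : ℝ))) ^ 2 ≤
      (1 + constM (1 / 2) * (2 + c)) * lam ^ (-1 : ℝ) := by
    intro c hc hrc
    have h7 : lam ^ (-1 : ℝ) * (Real.log r + 2 * Real.log lam) ≤ 2 + c := by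
      nlinarith [mul_le_mul_of_nonneg_left hrc h2.le, mul_le_of_le_one_left hc h3]
    have h8 := mul_le_mul_of_nonneg_left h7 (mul_nonneg hM0 h2.le)
    rw [h1] at h
    nlinarith
  unfold critK
  split_ifs with h1r
  · have hlog := Real.log_pos h1r
    rw [Real.sq_sqrt (by positivity)]
    exact key _ hlog.le le_rfl
  · rw [Real.sq_sqrt (by positivity)]
    have := key 0 le_rfl (Real.log_nonpos hr0.le (not_lt.1 h1r))
    rwa [add_zero, mul_comm _ (2 : ℝ)] at this

lemma constM_nonneg (α : ℝ) : 0 ≤ constM α := by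
  unfold constM
  split_ifs <;> positivity

lemma psiI_nonneg (α r : ℝ) : 0 ≤ psiI α r := by
  unfold psiI critK
  split_ifs <;> positivity

/-- The exponent is 2, 1 or 1/α in the three cases and does not depend on κ. It is written through
`gammaExp` so that, with lam ≥ L² and the tail factor L^{2-κ}, the total power is L^{-γ}. -/
theorem integral_relaxation_sq_le_psiI (hα : 0 < α) (hα1 : α ≤ 1) {lam r : ℝ} (κ : ℝ)
    (hlam : 1 ≤ lam) (hr : lam ^ (-(1 / α)) < r) :
    ∫ u in (0 : ℝ)..r, mittagLeffler α (-(lam * u ^ α)) ^ 2 ≤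
      psiI α r ^ 2 * lam ^ (-((gammaExp α κ + 2 - κ) / 2)) := by
  have hM := constM_nonneg α
  have hr0 : 0 < r := (Real.rpow_pos_of_pos (by linarith) _).trans hr
  unfold psiI gammaExp
  rcases lt_trichotomy α (1 / 2) with h | h | h
  · rw [if_pos h, if_pos h, Real.sq_sqrt (by positivity), show -((κ + 2 + 2 - κ) / 2) = -2 by ring]
    exact integral_relaxation_sq_le_of_lt_half hα h hlam hr
  · subst h
    rw [if_neg (lt_irrefl _), if_neg (lt_irrefl _), if_pos rfl, if_pos rfl,
      show -((κ + 2 - κ) / 2) = -1 by ring]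
    exact integral_relaxation_sq_le_half hlam hr
  · rw [if_neg h.not_gt, if_neg h.not_gt, if_neg h.ne', if_neg h.ne',
      Real.sq_sqrt (by positivity), show -((κ + 2 / α - 2 + 2 - κ) / 2) = -(1 / α) by ring]
    exact integral_relaxation_sq_le_of_half_lt h hα1 hlam hr

lemma gammaExp_exponent_nonneg (hα : 0 < α) (κ : ℝ) : 0 ≤ (gammaExp α κ + 2 - κ) / 2 := by
  unfold gammaExp
  have : 0 < 2 / α := by positivity
  split_ifs <;> linarith

end KernelEstimates

/-! ### Tails of the series -/

section Tails

lemma sum_rpow_tail_le {p : ℝ} (hp : 1 < p) {L : ℕ} (hL : 1 ≤ L) (n : ℕ) :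
    ∑ i ∈ Finset.range n, ((L + 1 + i : ℕ) : ℝ) ^ (-p) ≤ (L : ℝ) ^ (1 - p) / (p - 1) := by
  have hL0 : (0 : ℝ) < L := by exact_mod_cast hL
  have hanti : AntitoneOn (fun x : ℝ ↦ x ^ (-p)) (Icc (L : ℝ) (L + n)) := fun x hx y _ hxy ↦
    Real.rpow_le_rpow_of_nonpos (hL0.trans_le hx.1) hxy (by linarith)
  have h := hanti.sum_le_integral
  have h0 : (0 : ℝ) ∉ uIcc (L : ℝ) (L + n) := by
    rw [uIcc_of_le (by simp)]
    exact fun h ↦ absurd h.1 (not_le.2 hL0)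
  rw [integral_rpow (.inr ⟨by linarith, h0⟩), show -p + 1 = -(p - 1) by ring, div_neg, ← neg_div,
    neg_sub, ← show 1 - p = -(p - 1) by ring] at h
  calc _ = ∑ i ∈ Finset.range n, ((L : ℝ) + ((i + 1 : ℕ) : ℝ)) ^ (-p) := by
        refine Finset.sum_congr rfl fun i _ ↦ ?_
        push_cast
        congr 1
        ring
    _ ≤ _ := h
    _ ≤ _ := by
      have h2 : 0 ≤ ((L : ℝ) + n) ^ (1 - p) := by positivity
      have h3 : 0 < p - 1 := by linarith
      gcongr
      linarith

/-- The summands 2ℓ^{1-κ} and ℓ^{-κ} are compared with integrals separately; L ≥ 1 merges both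
powers into L^{2-κ}. -/
lemma sum_weighted_tail_le {κ : ℝ} (hκ : 2 < κ) {L : ℕ} (hL : 1 ≤ L) (n : ℕ) :
    ∑ i ∈ Finset.range n, (2 * ((L + 1 + i : ℕ) : ℝ) + 1) * ((L + 1 + i : ℕ) : ℝ) ^ (-κ) ≤
      (2 / (κ - 2) + 1 / (κ - 1)) * (L : ℝ) ^ (2 - κ) := by
  have hL0 : (1 : ℝ) ≤ L := by exact_mod_cast hL
  have h1 := sum_rpow_tail_le (p := κ - 1) (by linarith) hL n
  have h2 := sum_rpow_tail_le (p := κ) (by linarith) hL n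
  have h3 : (L : ℝ) ^ (1 - κ) ≤ (L : ℝ) ^ (2 - κ) :=
    Real.rpow_le_rpow_of_exponent_le hL0 (by linarith)
  have h4 : (L : ℝ) ^ (1 - κ) / (κ - 1) ≤ (L : ℝ) ^ (2 - κ) / (κ - 1) :=
    div_le_div_of_nonneg_right h3 (by linarith)
  rw [show 1 - (κ - 1) = 2 - κ by ring, show κ - 1 - 1 = κ - 2 by ring] at h1
  calc _ = 2 * ∑ i ∈ Finset.range n, ((L + 1 + i : ℕ) : ℝ) ^ (-(κ - 1)) +
        ∑ i ∈ Finset.range n, ((L + 1 + i : ℕ) : ℝ) ^ (-κ) := by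
        rw [Finset.mul_sum, ← Finset.sum_add_distrib]
        refine Finset.sum_congr rfl fun i _ ↦ ?_
        have hpos : (0 : ℝ) < ((L + 1 + i : ℕ) : ℝ) := by positivity
        rw [show -(κ - 1) = -κ + 1 by ring, Real.rpow_add_one hpos.ne']
        ring
    _ ≤ 2 * ((L : ℝ) ^ (2 - κ) / (κ - 2)) + (L : ℝ) ^ (2 - κ) / (κ - 1) := by linarith
    _ = _ := by ring

end Tails

/-! ### The Fourier coefficients of the noise -/

section Noise

lemma inner_toLp_continuous (f : L2Sphere) (g : C(Sphere2, ℝ)) :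
    ⟪f, ContinuousMap.toLp 2 sphereMeasure ℝ g⟫_ℝ = ∫ x, f x * g x ∂sphereMeasure := by
  rw [L2.inner_def]
  refine integral_congr_ae ?_
  filter_upwards [ContinuousMap.coeFn_toLp (p := 2) (𝕜 := ℝ) sphereMeasure g] with x hx
  rw [hx]
  exact mul_comm _ _

lemma integrable_mul_conj_sphericalHarmonic (ℓ : ℕ) (m : ℤ) (f : L2Sphere) :
    Integrable (fun x ↦ (f x : ℂ) * (starRingEnd ℂ) (sphericalHarmonic ℓ m x)) sphereMeasure := by
  have h1 : Integrable (fun x ↦ (f x : ℂ)) sphereMeasure :=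
    ((Lp.memLp f).integrable one_le_two).ofReal
  refine h1.mul_bdd (c := ‖sphericalHarmonic ℓ m‖)
    (Complex.continuous_conj.comp (sphericalHarmonic ℓ m).continuous).aestronglyMeasurable ?_
  filter_upwards with x
  rw [RCLike.norm_conj]
  exact (sphericalHarmonic ℓ m).norm_coe_le_norm x

lemma fourierCoeff_re (ℓ : ℕ) (m : ℤ) (f : L2Sphere) :
    (fourierCoeff ℓ m f).re = ⟪f, reHarmonic ℓ m⟫_ℝ := by
  rw [reHarmonic, inner_toLp_continuous, fourierCoeff, ← Complex.reCLM_apply,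
    ← Complex.reCLM.integral_comp_comm (integrable_mul_conj_sphericalHarmonic ℓ m f)]
  simp

lemma fourierCoeff_im (ℓ : ℕ) (m : ℤ) (f : L2Sphere) :
    (fourierCoeff ℓ m f).im = -⟪f, imHarmonic ℓ m⟫_ℝ := by
  rw [imHarmonic, inner_toLp_continuous, fourierCoeff, ← Complex.imCLM_apply,
    ← Complex.imCLM.integral_comp_comm (integrable_mul_conj_sphericalHarmonic ℓ m f),
    ← integral_neg]
  simp

lemma inner_reHarmonic_add_inner_imHarmonic (ℓ : ℕ) (m : ℤ) (hm : m.natAbs ≤ ℓ) :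
    ⟪reHarmonic ℓ m, reHarmonic ℓ m⟫_ℝ + ⟪imHarmonic ℓ m, imHarmonic ℓ m⟫_ℝ = 1 := by
  have h := integral_sphericalHarmonic_mul_conj ℓ ℓ m m hm
  rw [if_pos (by simp)] at h
  have e1 : ⟪reHarmonic ℓ m, reHarmonic ℓ m⟫_ℝ =
      ∫ x, (sphericalHarmonic ℓ m x).re * (sphericalHarmonic ℓ m x).re ∂sphereMeasure := by
    conv_lhs => rw [reHarmonic, inner_toLp_continuous]
    refine integral_congr_ae ?_
    filter_upwards [ContinuousMap.coeFn_toLp (p := 2) (𝕜 := ℝ) sphereMeasure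
      ⟨fun x ↦ (sphericalHarmonic ℓ m x).re, by fun_prop⟩] with x hx
    rw [hx]
    rfl
  have e2 : ⟪imHarmonic ℓ m, imHarmonic ℓ m⟫_ℝ =
      ∫ x, (sphericalHarmonic ℓ m x).im * (sphericalHarmonic ℓ m x).im ∂sphereMeasure := by
    conv_lhs => rw [imHarmonic, inner_toLp_continuous]
    refine integral_congr_ae ?_
    filter_upwards [ContinuousMap.coeFn_toLp (p := 2) (𝕜 := ℝ) sphereMeasure
      ⟨fun x ↦ (sphericalHarmonic ℓ m x).im, by fun_prop⟩] with x hx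
    rw [hx]
    rfl
  rw [e1, e2, ← integral_add (integrable_sphere_continuous (by fun_prop))
    (integrable_sphere_continuous (by fun_prop))]
  simp only [Complex.mul_conj, Complex.normSq_apply] at h
  rw [integral_complex_ofReal] at h
  exact_mod_cast h

variable {Ω : Type*} [MeasurableSpace Ω] {P : Measure Ω} {τ : ℝ}
  {Q : L2Sphere →L[ℝ] L2Sphere} {W : ℝ → Ω → L2Sphere}

namespace IsDelayedQWiener

lemma hasLaw_inner (hW : IsDelayedQWiener P τ Q W) (f : L2Sphere) {s : ℝ} (hs : 0 ≤ s) :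
    HasLaw (fun ω ↦ ⟪W (τ + s) ω, f⟫_ℝ) (gaussianReal 0 ((s * ⟪Q f, f⟫_ℝ).toNNReal)) P := by
  have h := hW.gaussian τ (τ + s) le_rfl (by linarith) f
  rw [add_sub_cancel_left] at h
  refine h.congr ?_
  filter_upwards [hW.start] with ω hω
  rw [hω, sub_zero]

lemma memLp_inner (hW : IsDelayedQWiener P τ Q W) (f : L2Sphere) {s : ℝ} (hs : 0 ≤ s) :
    MemLp (fun ω ↦ ⟪W (τ + s) ω, f⟫_ℝ) 2 P := by
  have h := hW.hasLaw_inner f hs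
  have h2 := memLp_id_gaussianReal (μ := 0) (v := (s * ⟪Q f, f⟫_ℝ).toNNReal) 2
  rw [← h.map_eq] at h2
  exact (memLp_map_measure_iff (by fun_prop) h.aemeasurable).1 h2

lemma integrable_inner_mul_inner (hW : IsDelayedQWiener P τ Q W) (f : L2Sphere) {s t : ℝ}
    (hs : 0 ≤ s) (ht : 0 ≤ t) :
    Integrable (fun ω ↦ ⟪W (τ + s) ω, f⟫_ℝ * ⟪W (τ + t) ω, f⟫_ℝ) P :=
  (hW.memLp_inner f hs).integrable_mul (hW.memLp_inner f ht)

lemma integral_inner_sq (hW : IsDelayedQWiener P τ Q W) (f : L2Sphere) {s : ℝ} (hs : 0 ≤ s) :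
    ∫ ω, ⟪W (τ + s) ω, f⟫_ℝ ^ 2 ∂P = s * ⟪Q f, f⟫_ℝ := by
  have h := hW.hasLaw_inner f hs
  have h1 : ∫ ω, ⟪W (τ + s) ω, f⟫_ℝ ∂P = 0 := by
    rw [h.integral_eq]
    exact integral_id_gaussianReal
  rw [← variance_of_integral_eq_zero h.aemeasurable h1, h.variance_eq, variance_id_gaussianReal]
  -- Positivity of Q ensures that `toNNReal` does not truncate the variance.
  exact Real.coe_toNNReal _ (mul_nonneg hs (hW.covariance_pos.inner_nonneg_left f))

/-- The increment from s to t is independent of the value at s, which has mean zero, so only the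
second moment at time s survives. -/
lemma integral_inner_mul_inner (hW : IsDelayedQWiener P τ Q W) (f : L2Sphere) {s t : ℝ}
    (hs : 0 ≤ s) (hst : s ≤ t) :
    ∫ ω, ⟪W (τ + s) ω, f⟫_ℝ * ⟪W (τ + t) ω, f⟫_ℝ ∂P = s * ⟪Q f, f⟫_ℝ := by
  have ht := hs.trans hst
  lift s to ℝ≥0 using id hs
  lift t to ℝ≥0 using id ht
  have hind := hW.indep.indepFun_eval_sub (r := 0) (s := s) (t := t) bot_le (by exact_mod_cast hst)
    (by simpa using hW.start)
  have hmeas : Measurable fun x : L2Sphere ↦ ⟪x, f⟫_ℝ := by fun_prop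
  have ms := hW.memLp_inner f hs
  have mt := hW.memLp_inner f ht
  have h0 := (hind.comp hmeas hmeas).integral_fun_mul_eq_mul_integral ms.1 (by
    refine (mt.1.sub ms.1).congr (.of_forall fun ω ↦ ?_)
    simp [inner_sub_left])
  have h1 : ∫ ω, ⟪W (τ + s) ω, f⟫_ℝ ∂P = 0 := by
    rw [(hW.hasLaw_inner f hs).integral_eq]
    exact integral_id_gaussianReal
  simp only [Function.comp_apply, Pi.sub_apply, inner_sub_left, h1, zero_mul, mul_sub] at h0
  rw [integral_sub (hW.integrable_inner_mul_inner f hs ht)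
    (hW.integrable_inner_mul_inner f hs hs), sub_eq_zero] at h0
  rw [h0, ← hW.integral_inner_sq f hs]
  simp only [sq]

/-- The real inner product of ℂ pairs real with real and imaginary with imaginary parts, so no
cross-covariance is needed. The two variances add up to A_ℓ because Y_{ℓ,m} has norm one. -/
lemma hasBrownianCovariance_noiseCoeff (hW : IsDelayedQWiener P τ Q W) {A : ℕ → ℝ}
    (hA : IsAngularPowerSpectrum Q A) {ℓ : ℕ} {m : ℤ} (h1 : -(ℓ : ℤ) ≤ m) (h2 : m ≤ ℓ) :
    HasBrownianCovariance P (noiseCoeff τ W ℓ m) (A ℓ) := by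
  have key : ∀ s ω, noiseCoeff τ W ℓ m s ω = ((⟪W (τ + s) ω, reHarmonic ℓ m⟫_ℝ : ℝ) : ℂ) +
      ((-⟪W (τ + s) ω, imHarmonic ℓ m⟫_ℝ : ℝ) : ℂ) * Complex.I := by
    intro s ω
    rw [← fourierCoeff_re, ← fourierCoeff_im]
    exact (Complex.re_add_im _).symm
  refine ⟨fun s hs ↦ ?_, fun s t hs hst ↦ ?_⟩
  · have e : noiseCoeff τ W ℓ m s =
        (Complex.ofRealCLM ∘ fun ω ↦ ⟪W (τ + s) ω, reHarmonic ℓ m⟫_ℝ) +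
        fun ω ↦ Complex.I * (Complex.ofRealCLM ∘ (-fun ω ↦ ⟪W (τ + s) ω, imHarmonic ℓ m⟫_ℝ)) ω := by
      ext ω
      rw [key, mul_comm _ Complex.I]
      rfl
    rw [e]
    exact (Complex.ofRealCLM.comp_memLp' (hW.memLp_inner _ hs)).add
      ((Complex.ofRealCLM.comp_memLp' (hW.memLp_inner _ hs).neg).const_mul Complex.I)
  · have ht := hs.trans hst
    have e : ∀ ω, ⟪noiseCoeff τ W ℓ m s ω, noiseCoeff τ W ℓ m t ω⟫_ℝ =
        ⟪W (τ + s) ω, reHarmonic ℓ m⟫_ℝ * ⟪W (τ + t) ω, reHarmonic ℓ m⟫_ℝ +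
        ⟪W (τ + s) ω, imHarmonic ℓ m⟫_ℝ * ⟪W (τ + t) ω, imHarmonic ℓ m⟫_ℝ := by
      intro ω
      rw [Complex.inner, key, key]
      simp only [map_add, map_mul, Complex.conj_ofReal, Complex.conj_I, Complex.mul_re,
        Complex.add_re, Complex.add_im, Complex.mul_im, Complex.ofReal_re, Complex.ofReal_im,
        Complex.neg_re, Complex.neg_im, Complex.I_re, Complex.I_im]
      ring
    simp only [e]
    rw [integral_add (hW.integrable_inner_mul_inner _ hs ht) (hW.integrable_inner_mul_inner _ hs ht),
      hW.integral_inner_mul_inner _ hs hst, hW.integral_inner_mul_inner _ hs hst,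
      hA.map_re ℓ m h1 h2, hA.map_im ℓ m h1 h2, real_inner_smul_left, real_inner_smul_left]
    have := inner_reHarmonic_add_inner_imHarmonic ℓ m (by omega)
    linear_combination (A ℓ * s) * this

end IsDelayedQWiener

end Noise

/-! ### Orthogonality of the parts of the solution -/

section Parts

variable {Ω : Type*} [MeasurableSpace Ω] {P : Measure Ω} [IsProbabilityMeasure P]

lemma inner_tensor (Z Z' : Lp ℂ 2 P) (f f' : C(Sphere2, ℂ)) :
    ⟪tensor P Z f, tensor P Z' f'⟫_ℂ =
      ⟪Z, Z'⟫_ℂ * ∫ x, f' x * (starRingEnd ℂ) (f x) ∂sphereMeasure := by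
  rw [L2.inner_def, L2.inner_def, ← integral_prod_mul]
  refine integral_congr_ae ?_
  filter_upwards [(memLp_tensor P Z f).coeFn_toLp, (memLp_tensor P Z' f').coeFn_toLp] with p h1 h2
  rw [tensor, tensor, h1, h2]
  simp only [RCLike.inner_apply, map_mul]
  ring

lemma inner_tensor_sphericalHarmonic (Z Z' : Lp ℂ 2 P) (ℓ k : ℕ) (m n : ℤ) (hn : n.natAbs ≤ k) :
    ⟪tensor P Z (sphericalHarmonic ℓ m), tensor P Z' (sphericalHarmonic k n)⟫_ℂ =
      if k = ℓ ∧ n = m then ⟪Z, Z'⟫_ℂ else 0 := by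
  rw [inner_tensor, integral_sphericalHarmonic_mul_conj k ℓ n m hn]
  split_ifs <;> simp

variable {τ : ℝ} {W : ℝ → Ω → L2Sphere} {α : ℝ}

/-- Orthogonality comes from the sphere variable alone; nothing about the correlation of the
coefficients enters. -/
lemma inner_inhomPart_of_ne {t : ℝ} {ℓ k : ℕ} (h : ℓ ≠ k) :
    ⟪inhomPart P α τ W ℓ t, inhomPart P α τ W k t⟫_ℂ = 0 := by
  unfold inhomPart
  split_ifs
  · simp
  · simp only [sum_inner, inner_sum]
    refine Finset.sum_eq_zero fun n hn ↦ Finset.sum_eq_zero fun m hm ↦ ?_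
    rw [inner_tensor_sphericalHarmonic, if_neg (by tauto)]
    have := Finset.mem_Icc.1 hn
    have := Finset.mem_Icc.1 hm
    omega

lemma norm_inhomPart_sq {t : ℝ} (ht : τ < t) (ℓ : ℕ) :
    ‖inhomPart P α τ W ℓ t‖ ^ 2 =
      ∑ m ∈ Finset.Icc (-(ℓ : ℤ)) ℓ, ‖inhomCoeff P α τ W ℓ m t‖ ^ 2 := by
  have h : ⟪inhomPart P α τ W ℓ t, inhomPart P α τ W ℓ t⟫_ℂ =
      ∑ m ∈ Finset.Icc (-(ℓ : ℤ)) ℓ,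
        ⟪inhomCoeff P α τ W ℓ m t, inhomCoeff P α τ W ℓ m t⟫_ℂ := by
    rw [inhomPart, if_neg (not_le.2 ht), inner_sum]
    refine Finset.sum_congr rfl fun n hn ↦ ?_
    have hn' : n.natAbs ≤ ℓ := by
      have := Finset.mem_Icc.1 hn
      omega
    rw [sum_inner, Finset.sum_eq_single n]
    · rw [inner_tensor_sphericalHarmonic _ _ _ _ _ _ hn', if_pos ⟨rfl, rfl⟩]
    · intro m _ hmn
      rw [inner_tensor_sphericalHarmonic _ _ _ _ _ _ hn', if_neg (by tauto)]
    · exact fun h ↦ absurd hn h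
  simp only [inner_self_eq_norm_sq_to_K] at h
  exact_mod_cast h

end Parts

/-! ### Orthogonal series -/

section OrthogonalSeries

variable {H : Type*} [NormedAddCommGroup H] [InnerProductSpace ℂ H]

lemma norm_sum_sq_of_orthogonal {v : ℕ → H} (hv : ∀ i j, i ≠ j → ⟪v i, v j⟫_ℂ = 0)
    (s : Finset ℕ) : ‖∑ i ∈ s, v i‖ ^ 2 = ∑ i ∈ s, ‖v i‖ ^ 2 := by
  have h : ⟪∑ i ∈ s, v i, ∑ i ∈ s, v i⟫_ℂ = ∑ i ∈ s, ⟪v i, v i⟫_ℂ := by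
    rw [inner_sum]
    refine Finset.sum_congr rfl fun j hj ↦ ?_
    rw [sum_inner, Finset.sum_eq_single j (fun i _ hij ↦ hv i j hij) (fun h ↦ absurd hj h)]
  simp only [inner_self_eq_norm_sq_to_K] at h
  exact_mod_cast h

/-- By Pythagoras the Cauchy criterion for Σ v_i is that for Σ ‖v_i‖². -/
lemma summable_of_orthogonal [CompleteSpace H] {v : ℕ → H}
    (hv : ∀ i j, i ≠ j → ⟪v i, v j⟫_ℂ = 0) (hs : Summable fun i ↦ ‖v i‖ ^ 2) : Summable v := by
  rw [summable_iff_vanishing_norm] at hs ⊢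
  intro ε hε
  obtain ⟨s, h⟩ := hs (ε ^ 2) (by positivity)
  refine ⟨s, fun t ht ↦ ?_⟩
  have h1 := h t ht
  rw [← norm_sum_sq_of_orthogonal hv, norm_pow, norm_norm] at h1
  exact lt_of_pow_lt_pow_left₀ 2 hε.le h1

lemma norm_tsum_sq_le_of_orthogonal {v : ℕ → H} (hv : ∀ i j, i ≠ j → ⟪v i, v j⟫_ℂ = 0)
    (hs : Summable v) {C : ℝ} (hC : ∀ n, ∑ i ∈ Finset.range n, ‖v i‖ ^ 2 ≤ C) :
    ‖∑' i, v i‖ ^ 2 ≤ C :=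
  le_of_tendsto (hs.hasSum.tendsto_sum_nat.norm.pow 2)
    (.of_forall fun n ↦ (norm_sum_sq_of_orthogonal hv _).le.trans (hC n))

end OrthogonalSeries

/-! ### The truncation error -/

section Truncation

variable {Ω : Type*} [MeasurableSpace Ω] {P : Measure Ω}
  {α τ : ℝ} {Q : L2Sphere →L[ℝ] L2Sphere} {W : ℝ → Ω → L2Sphere} {A : ℕ → ℝ}

lemma memLp_kernelML (hα : 0 < α) (ℓ : ℕ) (r : ℝ) :
    MemLp (kernelML α ℓ r) 2 (volume.restrict (Ioc 0 r)) := by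
  have hc := continuous_kernelML hα ℓ r
  obtain ⟨C, hC⟩ := isCompact_Icc.exists_bound_of_continuousOn (hc.continuousOn (s := Icc 0 r))
  refine MemLp.of_bound hc.aestronglyMeasurable C ?_
  filter_upwards [ae_restrict_mem measurableSet_Ioc] with u hu using hC u ⟨hu.1.le, hu.2⟩

theorem isWienerIntegral_inhomCoeff (hα : 0 < α) (hW : IsDelayedQWiener P τ Q W)
    (hA : IsAngularPowerSpectrum Q A) {t : ℝ} (ht : τ < t) {ℓ : ℕ} {m : ℤ} (h1 : -(ℓ : ℤ) ≤ m)
    (h2 : m ≤ ℓ) :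
    IsWienerIntegral P (noiseCoeff τ W ℓ m) 0 (t - τ) (kernelML α ℓ (t - τ))
      (inhomCoeff P α τ W ℓ m t) :=
  isWienerIntegral_wienerIntegral (exists_isWienerIntegral
    (hW.hasBrownianCovariance_noiseCoeff hA h1 h2) (hA.nonneg ℓ) (sub_pos.2 ht)
    (continuous_kernelML hα ℓ _) (memLp_kernelML hα ℓ _))

variable [IsProbabilityMeasure P]

theorem norm_inhomPart_sq_eq (hα : 0 < α) (hW : IsDelayedQWiener P τ Q W)
    (hA : IsAngularPowerSpectrum Q A) {t : ℝ} (ht : τ < t) (ℓ : ℕ) :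
    ‖inhomPart P α τ W ℓ t‖ ^ 2 = (2 * ℓ + 1) * (A ℓ * kernelEnergy α ℓ (t - τ)) := by
  rw [norm_inhomPart_sq ht, Finset.sum_congr rfl fun m hm ↦
    (isWienerIntegral_inhomCoeff hα hW hA ht (Finset.mem_Icc.1 hm).1
      (Finset.mem_Icc.1 hm).2).norm_sq (hW.hasBrownianCovariance_noiseCoeff hA
      (Finset.mem_Icc.1 hm).1 (Finset.mem_Icc.1 hm).2) (memLp_kernelML hα ℓ _),
    Finset.sum_const, Int.card_Icc, nsmul_eq_mul, kernelEnergy]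
  congr 1
  rw [show ((ℓ : ℤ) + 1 - -(ℓ : ℤ)).toNat = 2 * ℓ + 1 by omega]
  push_cast
  ring

lemma sum_norm_inhomPart_sq_le (hα : 0 < α) (hW : IsDelayedQWiener P τ Q W)
    (hA : IsAngularPowerSpectrum Q A) {Atilde κ : ℝ} (hAt : 0 < Atilde) (hκ : 2 < κ)
    (hdecay : ∀ ℓ : ℕ, 1 ≤ ℓ → A ℓ ≤ Atilde * (ℓ : ℝ) ^ (-κ)) {t : ℝ} (ht : τ < t) {L : ℕ}
    (hL : 1 ≤ L) {s : ℝ} (hs0 : 0 ≤ s) (hs : ∀ ℓ, L < ℓ → kernelEnergy α ℓ (t - τ) ≤ s) (n : ℕ) :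
    ∑ i ∈ Finset.range n, ‖inhomPart P α τ W (L + 1 + i) t‖ ^ 2 ≤
      s * (constA Atilde κ ^ 2 * (L : ℝ) ^ (2 - κ)) := by
  have hc : 0 ≤ Atilde * (2 / (κ - 2) + 1 / (κ - 1)) := by
    have h1 : 0 < κ - 2 := by linarith
    have h2 : 0 < κ - 1 := by linarith
    positivity
  rw [constA, Real.sq_sqrt hc]
  have h := mul_le_mul_of_nonneg_left (sum_weighted_tail_le hκ hL n) (mul_nonneg hs0 hAt.le)
  refine le_trans ?_ (h.trans_eq (by ring))
  rw [Finset.mul_sum]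
  refine Finset.sum_le_sum fun i _ ↦ ?_
  rw [norm_inhomPart_sq_eq hα hW hA ht]
  have h3 : A (L + 1 + i) * kernelEnergy α (L + 1 + i) (t - τ) ≤
      Atilde * ((L + 1 + i : ℕ) : ℝ) ^ (-κ) * s :=
    mul_le_mul (hdecay _ (by omega)) (hs _ (by omega))
      (setIntegral_nonneg measurableSet_Ioc fun _ _ ↦ sq_nonneg _) (by positivity)
  calc _ ≤ (2 * ((L + 1 + i : ℕ) : ℝ) + 1) * (Atilde * ((L + 1 + i : ℕ) : ℝ) ^ (-κ) * s) := by
        gcongr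
    _ = _ := by ring

lemma kernelEnergy_le (hα : 0 < α) (hα1 : α ≤ 1) (ℓ : ℕ) {r : ℝ} (hr : 0 < r) :
    kernelEnergy α ℓ r ≤ r := by
  rw [kernelEnergy_eq ℓ hr]
  exact integral_relaxation_sq_le hα hα1 (eigenvalue_nonneg ℓ) hr.le

theorem summable_inhomPart (hα : 0 < α) (hα1 : α ≤ 1) (hW : IsDelayedQWiener P τ Q W)
    (hA : IsAngularPowerSpectrum Q A) {Atilde κ : ℝ} (hAt : 0 < Atilde) (hκ : 2 < κ)
    (hdecay : ∀ ℓ : ℕ, 1 ≤ ℓ → A ℓ ≤ Atilde * (ℓ : ℝ) ^ (-κ)) {t : ℝ} (ht : τ < t) :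
    Summable fun ℓ : ℕ ↦ inhomPart P α τ W ℓ t := by
  refine summable_of_orthogonal (fun i j hij ↦ inner_inhomPart_of_ne hij) ?_
  -- The tail estimate with L = 1 starts at degree 2; dropping two terms does not affect
  -- summability.
  rw [← summable_nat_add_iff 2]
  refine summable_of_sum_range_le (c := (t - τ) * (constA Atilde κ ^ 2 * ((1 : ℕ) : ℝ) ^ (2 - κ)))
    (fun _ ↦ by positivity) fun n ↦ ?_
  · have h := sum_norm_inhomPart_sq_le hα hW hA hAt hκ hdecay ht le_rfl (sub_pos.2 ht).le
      (fun ℓ _ ↦ kernelEnergy_le hα hα1 ℓ (sub_pos.2 ht)) n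
    simpa only [add_comm _ 2, show 1 + 1 = 2 from rfl] using h

lemma truncationError_eq {t : ℝ} (hs : Summable fun ℓ : ℕ ↦ inhomPart P α τ W ℓ t) (L : ℕ) :
    truncationError P α τ W L t = ‖∑' ℓ : ℕ, inhomPart P α τ W (L + 1 + ℓ) t‖ := by
  rw [truncationError, inhomSolution, inhomTruncated, ← hs.sum_add_tsum_nat_add (L + 1),
    add_sub_cancel_left]
  simp only [add_comm _ (L + 1)]

lemma truncationError_sq_le (hα : 0 < α) (hα1 : α ≤ 1) (hW : IsDelayedQWiener P τ Q W)
    (hA : IsAngularPowerSpectrum Q A) {Atilde κ : ℝ} (hAt : 0 < Atilde) (hκ : 2 < κ)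
    (hdecay : ∀ ℓ : ℕ, 1 ≤ ℓ → A ℓ ≤ Atilde * (ℓ : ℝ) ^ (-κ)) {t : ℝ} (ht : τ < t) {L : ℕ}
    (hL : 1 ≤ L) {s : ℝ} (hs0 : 0 ≤ s) (hs : ∀ ℓ, L < ℓ → kernelEnergy α ℓ (t - τ) ≤ s) :
    truncationError P α τ W L t ^ 2 ≤ s * (constA Atilde κ ^ 2 * (L : ℝ) ^ (2 - κ)) := by
  have hsum := summable_inhomPart hα hα1 hW hA hAt hκ hdecay ht
  rw [truncationError_eq hsum]
  refine norm_tsum_sq_le_of_orthogonal (v := fun ℓ ↦ inhomPart P α τ W (L + 1 + ℓ) t)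
    (fun i j hij ↦ inner_inhomPart_of_ne (by omega)) ?_
    (sum_norm_inhomPart_sq_le hα hW hA hAt hκ hdecay ht hL hs0 hs)
  simpa only [add_comm _ (L + 1)] using (summable_nat_add_iff (L + 1)).2 hsum

lemma sq_le_eigenvalue (ℓ : ℕ) : (ℓ : ℝ) ^ 2 ≤ eigenvalue ℓ := by
  unfold eigenvalue
  nlinarith [(ℓ.cast_nonneg : (0 : ℝ) ≤ ℓ)]

lemma eigenvalue_rpow_neg_le {L ℓ : ℕ} (hL : 1 ≤ L) (hℓ : L ≤ ℓ) {e : ℝ} (he : 0 ≤ e) :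
    eigenvalue ℓ ^ (-e) ≤ (L : ℝ) ^ (-(2 * e)) := by
  have hL0 : (0 : ℝ) < L := by exact_mod_cast hL
  have h1 : (L : ℝ) ^ 2 ≤ eigenvalue ℓ :=
    (pow_le_pow_left₀ hL0.le (by exact_mod_cast hℓ) 2).trans (sq_le_eigenvalue ℓ)
  rw [show -(2 * e) = 2 * (-e) by ring, Real.rpow_mul hL0.le, Real.rpow_two]
  exact Real.rpow_le_rpow_of_nonpos (by positivity) h1 (by linarith)

lemma constA_nonneg (Atilde κ : ℝ) : 0 ≤ constA Atilde κ := Real.sqrt_nonneg _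

theorem truncationError_le_of_le (hα : 0 < α) (hα1 : α ≤ 1) (hW : IsDelayedQWiener P τ Q W)
    (hA : IsAngularPowerSpectrum Q A) {Atilde κ : ℝ} (hAt : 0 < Atilde) (hκ : 2 < κ)
    (hdecay : ∀ ℓ : ℕ, 1 ≤ ℓ → A ℓ ≤ Atilde * (ℓ : ℝ) ^ (-κ)) {t : ℝ} (ht : τ < t) {L : ℕ}
    (hL : 1 ≤ L) (htL : t ≤ τ + eigenvalue L ^ (-(1 / α))) :
    truncationError P α τ W L t ≤ constA Atilde κ * (L : ℝ) ^ (-((κ + 2 / α - 2) / 2)) := by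
  have hL0 : (0 : ℝ) < L := by exact_mod_cast hL
  have h1 := eigenvalue_rpow_neg_le hL le_rfl (e := 1 / α) (by positivity)
  -- For these times t - τ ≤ λ_L^{-1/α} ≤ L^{-2/α}, and t - τ bounds the energy of every degree.
  have h := truncationError_sq_le hα hα1 hW hA hAt hκ hdecay ht hL (s := (L : ℝ) ^ (-(2 * (1 / α))))
    (by positivity) fun ℓ _ ↦
      (kernelEnergy_le hα hα1 ℓ (sub_pos.2 ht)).trans ((by linarith : t - τ ≤ _).trans h1)
  refine le_of_sq_le_sq ?_ (mul_nonneg (constA_nonneg _ _) (by positivity))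
  refine h.trans_eq ?_
  rw [mul_pow, ← Real.rpow_natCast ((L : ℝ) ^ _), ← Real.rpow_mul hL0.le, mul_left_comm,
    ← Real.rpow_add hL0]
  congr 2
  push_cast
  ring

theorem truncationError_le_of_lt (hα : 0 < α) (hα1 : α ≤ 1) (hW : IsDelayedQWiener P τ Q W)
    (hA : IsAngularPowerSpectrum Q A) {Atilde κ : ℝ} (hAt : 0 < Atilde) (hκ : 2 < κ)
    (hdecay : ∀ ℓ : ℕ, 1 ≤ ℓ → A ℓ ≤ Atilde * (ℓ : ℝ) ^ (-κ)) {t : ℝ} (ht : τ < t) {L : ℕ}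
    (hL : 1 ≤ L) (htL : τ + eigenvalue L ^ (-(1 / α)) < t) :
    truncationError P α τ W L t ≤
      psiI α (t - τ) * constA Atilde κ * (L : ℝ) ^ (-(gammaExp α κ / 2)) := by
  have hL0 : (0 : ℝ) < L := by exact_mod_cast hL
  have hL1 : (1 : ℝ) ≤ L := by exact_mod_cast hL
  have he := gammaExp_exponent_nonneg hα κ
  have h := truncationError_sq_le hα hα1 hW hA hAt hκ hdecay ht hL
    (s := psiI α (t - τ) ^ 2 * (L : ℝ) ^ (-(2 * ((gammaExp α κ + 2 - κ) / 2))))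
    (by positivity) fun ℓ hℓ ↦ by
      -- The threshold λ_ℓ^{-1/α} decreases in ℓ, so t lies beyond it for every ℓ > L and the
      -- late-time bound holds for the whole tail.
      have hmono : eigenvalue L ≤ eigenvalue ℓ := by
        have : (L : ℝ) ≤ ℓ := by exact_mod_cast hℓ.le
        unfold eigenvalue
        gcongr
      have hLpos : 1 ≤ eigenvalue L := (one_le_pow₀ hL1).trans (sq_le_eigenvalue L)
      rw [kernelEnergy_eq ℓ (sub_pos.2 ht)]
      refine (integral_relaxation_sq_le_psiI hα hα1 κ (hLpos.trans hmono) ?_).trans ?_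
      · have : eigenvalue ℓ ^ (-(1 / α)) ≤ eigenvalue L ^ (-(1 / α)) :=
          Real.rpow_le_rpow_of_nonpos (by linarith) hmono (neg_nonpos.2 (by positivity))
        linarith
      · exact mul_le_mul_of_nonneg_left (eigenvalue_rpow_neg_le hL hℓ.le he) (sq_nonneg _)
  refine le_of_sq_le_sq ?_ (mul_nonneg (mul_nonneg (psiI_nonneg _ _) (constA_nonneg _ _))
    (by positivity))
  refine h.trans_eq ?_
  have e1 : (L : ℝ) ^ (-(2 * ((gammaExp α κ + 2 - κ) / 2))) * (L : ℝ) ^ (2 - κ) =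
      ((L : ℝ) ^ (-(gammaExp α κ / 2))) ^ 2 := by
    rw [← Real.rpow_natCast ((L : ℝ) ^ _), ← Real.rpow_mul hL0.le, ← Real.rpow_add hL0]
    congr 1
    push_cast
    ring
  linear_combination (psiI α (t - τ) ^ 2 * constA Atilde κ ^ 2) * e1

end Truncation

end SphereDiffusion

theorem proposition5p3 {Ω : Type*} [MeasurableSpace Ω] (P : Measure Ω) [IsProbabilityMeasure P]
    (α τ : ℝ) (hα₀ : 0 < α) (hα₁ : α ≤ 1) (hτ : 0 ≤ τ)
    (Q : L2Sphere →L[ℝ] L2Sphere) (W : ℝ → Ω → L2Sphere) (hW : IsDelayedQWiener P τ Q W)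
    (A : ℕ → ℝ) (hA : IsAngularPowerSpectrum Q A)
    (Ktilde Atilde κ₂ : ℝ) (hK : 0 < Ktilde) (hAtilde : 0 < Atilde) (hκ₂ : 2 < κ₂)
    (hA₀ : A 0 ≤ Ktilde) (hdecay : ∀ ℓ : ℕ, 1 ≤ ℓ → A ℓ ≤ Atilde * (ℓ : ℝ) ^ (-κ₂)) :
    -- for `t > τ` the stochastic integrals exist and the series of `U^I(t)` converges
    (∀ t : ℝ, τ < t →
      (∀ (ℓ : ℕ) (m : ℤ), -(ℓ : ℤ) ≤ m → m ≤ ℓ →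
        IsWienerIntegral P (noiseCoeff τ W ℓ m) 0 (t - τ) (kernelML α ℓ (t - τ))
          (inhomCoeff P α τ W ℓ m t)) ∧
      Summable (fun ℓ : ℕ ↦ inhomPart P α τ W ℓ t)) ∧
    ∀ L : ℕ, 1 ≤ L → ∀ t : ℝ, τ < t →
      truncationError P α τ W L t = ‖∑' ℓ : ℕ, inhomPart P α τ W (L + 1 + ℓ) t‖ ∧
      (t ≤ τ + eigenvalue L ^ (-(1 / α)) →
        truncationError P α τ W L t ≤
          constA Atilde κ₂ * (L : ℝ) ^ (-((κ₂ + 2 / α - 2) / 2))) ∧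
      (τ + eigenvalue L ^ (-(1 / α)) < t →
        truncationError P α τ W L t ≤
          psiI α (t - τ) * constA Atilde κ₂ * (L : ℝ) ^ (-(gammaExp α κ₂ / 2))) := by
  refine ⟨fun t ht ↦ ⟨fun ℓ m h1 h2 ↦ isWienerIntegral_inhomCoeff hα₀ hW hA ht h1 h2,
    summable_inhomPart hα₀ hα₁ hW hA hAtilde hκ₂ hdecay ht⟩, fun L hL t ht ↦
    ⟨truncationError_eq (summable_inhomPart hα₀ hα₁ hW hA hAtilde hκ₂ hdecay ht) L,
      truncationError_le_of_le hα₀ hα₁ hW hA hAtilde hκ₂ hdecay ht hL,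
      truncationError_le_of_lt hα₀ hα₁ hW hA hAtilde hκ₂ hdecay ht hL⟩⟩
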